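/- Let $k$ be any field. Define rational numbers $\beta_0=1$, $\beta_1=\tfrac32$, $\beta_i=2\beta_{i-1}+\tfrac1{2^i}$ for $i\ge 2$, and $\bar\gamma_1=\tfrac94$, $\bar\gamma_2=\tfrac{13}3$, $\bar\gamma_{i+1}=3\bar\gamma_i+\tfrac1{3^i}$ for $i\ge 2$. Define polynomials in $k[x,y,z]$ by $$P_0=x,\quad P_1=y,\quad P_2=y^2-x^3,\quad P_i=P_{i-1}^2-x^{5\cdot 2^{i-3}}P_{i-2}\ (i\ge 3),$$ $$Q_1=z,\quad Q_2=xz-P_2,\quad Q_3=Q_2^3-x^{13},\quad Q_{i+1}=Q_i^3-x^{35\cdot 3^{i-3}}Q_{i-1}\ (i\ge 3),$$ $$R_1=Q_1=z,\quad R_i=R_{i-1}^2-x^{3\cdot 2^{i-2}}P_{i-1}\ (i\ge 2).$$ (1) The $P_i,Q_i$ are the defining polynomials attached to the data $\{\beta_i\},\{\bar\gamma_i\}$ with all residues equal to $1$. That is, put $G_i=\sum_{j=0}^i\beta_j\mathbb Z$, $G=\bigcup_i G_i$, $\bar H_i=\sum_{j=1}^i\bar\gamma_j\mathbb Z$ and,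 for $i\ge 1$, $q_i=\min\{q>0: q\beta_i\in G_{i-1}\}$, $\bar s_i=\min\{s>0: s\bar\gamma_i\in \bar H_{i-1}+G\}$, $\bar m_0=0$, $\bar m_i=\max(\bar m_{i-1},\min\{j\ge 0:\bar s_i\bar\gamma_i\in\bar H_{i-1}+G_j\})$. Then there are integers $n_{i,j},\bar n_{i,j},\bar l_{i,j}\ge 0$ and $a_i\in\mathbb Z$ with $n_{i,j},\bar n_{i,j}<q_j$ and $\bar l_{i,j}<\bar s_j$ for $j\ge 1$ such that, for all $i\ge 1$, $$q_i\beta_i=\sum_{j=0}^{i-1}n_{i,j}\beta_j,\qquad \bar s_i\bar\gamma_i=a_i\beta_0+\sum_{j=1}^{\bar m_i}\bar n_{i,j}\beta_j+\sum_{j=1}^{i-1}\bar l_{i,j}\bar\gamma_j,$$ and, with $\bar n_{i,0}=\max(0,a_i)$ and $\bar r_{i,0}=\max(0,-a_i)$, $$P_{i+1}=P_i^{q_i}-\prod_{j=0}^{i-1}P_j^{n_{i,j}},\qquad Q_{i+1}=x^{\bar r_{i,0}}Q_i^{\bar s_i}-\prod_{j=0}^{\bar m_i}P_j^{\bar n_{i,j}}\prod_{j=1}^{i-1}Q_j^{\bar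 l_{i,j}}.$$ Moreover $\bar r_{1,0}=1$ and $\bar r_{i,0}=0$ for $i\ge 2$; all $\beta_i$ and $\bar\gamma_i$ are positive; $\beta_{i+1}>q_i\beta_i$ and $\bar\gamma_{i+1}>\bar r_{i,0}\beta_0+\bar s_i\bar\gamma_i$ for all $i\ge 1$; and infinitely many $q_i$ and infinitely many $\bar s_i$ are greater than $1$. (2) There is a unique valuation $\nu$ of $k(x,y,z)$ with values in $\mathbb Q$ (and $\nu(0)=\infty$) that dominates $A=k[x,y,z]_{(x,y,z)}$ and satisfies $\nu(P_i)=\beta_i$ for all $i\ge 0$ and $\nu(Q_i)=\bar\gamma_i$ for all $i\ge 1$. (3) For this $\nu$ one has $\nu(R_i)=\beta_{i+1}-2^{i-1}$ for all $i\ge 1$, and the value semigroup $\nu(A)=\{\nu(f): 0\ne f\in A\}$ is the semigroup (with $0$) generated by the values of $x$, $y$, the $Q_i$ ($i\ge 2$) and the $R_i$ ($i\ge 1$), that is, by $$\{1,\tfrac32\}\cup\{\beta_{i+1}-2^{i-1}: i\ge 1\}\cup\{\bar\gamma_i: i\ge 2\}=\left\{1,\,1\tfrac12,\,2\tfrac14,\,4\tfrac58,\,9\tfrac5{16},\dots\right\}\cup\left\{4\tfrac13,\,13\tfrac19,\,39\tfrac{10}{27},\dots\right\}.$$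 -/

import Mathlib

open MvPolynomial

noncomputable section

namespace ValSemigroup

/-! ### Valuations of `k(x, y, z)` and the local ring `k[x, y, z]_{(x, y, z)}` -/

/-- The polynomial ring `k[x, y, z]`. -/
abbrev Poly (k : Type*) [Field k] := MvPolynomial (Fin 3) k

/-- The field `k(x, y, z)` of rational functions. -/
abbrev RatFun (k : Type*) [Field k] := FractionRing (Poly k)

/-- The ideal `(x, y, z)` of `k[x, y, z]`. -/
def originIdeal (k : Type*) [Field k] : Ideal (Poly k) := Ideal.span {X 0, X 1, X 2}

theorem mem_originIdeal_iff {k : Type*} [Field k] (f : Poly k) :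
    f ∈ originIdeal k ↔ constantCoeff f = 0 := by
  have hs : ({X 0, X 1, X 2} : Set (Poly k)) = X '' Set.univ := by
    ext p
    simp [Fin.exists_fin_succ, eq_comm]
  rw [originIdeal, hs, mem_ideal_span_X_image]
  constructor
  · intro h
    by_contra hc
    have h0 : (0 : Fin 3 →₀ ℕ) ∈ f.support := by
      rw [mem_support_iff]
      simpa [constantCoeff_eq] using hc
    obtain ⟨i, -, hi⟩ := h 0 h0
    exact hi rfl
  · intro h m hm
    by_contra hc
    push Not at hc
    have : m = 0 := by
      ext i
      exact hc i (Set.mem_univ i)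
    subst this
    rw [mem_support_iff] at hm
    exact hm (by simpa [constantCoeff_eq] using h)

/-- The local ring `k[x, y, z]_{(x, y, z)}` as a subring of `k(x, y, z)`: all fractions `a / b` of
polynomials with `b ∉ (x, y, z)`. -/
def localRing (k : Type*) [Field k] : Subring (RatFun k) where
  carrier := {f | ∃ a b : Poly k, b ∉ originIdeal k ∧
    f = algebraMap (Poly k) (RatFun k) a / algebraMap (Poly k) (RatFun k) b}
  zero_mem' := ⟨0, 1, by simp [mem_originIdeal_iff], by simp⟩
  one_mem' := ⟨1, 1, by simp [mem_originIdeal_iff], by simp⟩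
  add_mem' := by
    rintro _ _ ⟨a, b, hb, rfl⟩ ⟨c, d, hd, rfl⟩
    rw [mem_originIdeal_iff] at hb hd
    have hb' : algebraMap (Poly k) (RatFun k) b ≠ 0 := by
      rw [Ne, IsFractionRing.to_map_eq_zero_iff]; rintro rfl; simp at hb
    have hd' : algebraMap (Poly k) (RatFun k) d ≠ 0 := by
      rw [Ne, IsFractionRing.to_map_eq_zero_iff]; rintro rfl; simp at hd
    refine ⟨a * d + b * c, b * d, ?_, ?_⟩
    · rw [mem_originIdeal_iff, map_mul]
      exact mul_ne_zero hb hd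
    · rw [div_add_div _ _ hb' hd']
      simp only [map_add, map_mul]
  mul_mem' := by
    rintro _ _ ⟨a, b, hb, rfl⟩ ⟨c, d, hd, rfl⟩
    rw [mem_originIdeal_iff] at hb hd
    refine ⟨a * c, b * d, ?_, ?_⟩
    · rw [mem_originIdeal_iff, map_mul]
      exact mul_ne_zero hb hd
    · rw [div_mul_div_comm]
      simp only [map_mul]
  neg_mem' := by
    rintro _ ⟨a, b, hb, rfl⟩
    exact ⟨-a, b, hb, by rw [map_neg, neg_div]⟩

/-- `ν` dominates the local subring `A` of the field `K`: `A` lies in the valuation ring of `ν`, and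
the elements of `A` of positive value are exactly those of the maximal ideal (the nonunits) of
`A`. -/
def Dominates {K : Type*} [Field K] (ν : AddValuation K (WithTop ℚ)) (A : Subring K) : Prop :=
  ∀ f : A, 0 ≤ ν (f : K) ∧ (0 < ν (f : K) ↔ f ∈ nonunits A)

/-- The value semigroup `ν(A)`: all values `ν f` with `0 ≠ f ∈ A`. -/
def valueSemigroup {K : Type*} [Field K] (ν : AddValuation K (WithTop ℚ)) (A : Subring K) :
    Set ℚ :=
  {v | ∃ f ∈ A, f ≠ 0 ∧ ν f = (v : WithTop ℚ)}

/-- The value of a polynomial under a valuation of `k(x, y, z)`. -/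
def polyVal {k : Type*} [Field k] (ν : AddValuation (RatFun k) (WithTop ℚ)) (f : Poly k) :
    WithTop ℚ :=
  ν (algebraMap (Poly k) (RatFun k) f)

/-! ### Numerical data and defining polynomials

The data are two sequences of rational numbers `β 0, β 1, …` and `γ 1, γ 2, …`; the entry `γ 0` is
never used. -/

/-- `G_i = β_0 ℤ + ⋯ + β_i ℤ`. -/
def groupG (β : ℕ → ℚ) (i : ℕ) : AddSubgroup ℚ := AddSubgroup.closure (β '' {j | j ≤ i})

/-- The union `G` of all `G_i`. -/
def groupGUnion (β : ℕ → ℚ) : AddSubgroup ℚ := AddSubgroup.closure (Set.range β)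

/-- `H_i = γ_1 ℤ + ⋯ + γ_i ℤ`. -/
def groupH (γ : ℕ → ℚ) (i : ℕ) : AddSubgroup ℚ :=
  AddSubgroup.closure (γ '' {j | 1 ≤ j ∧ j ≤ i})

/-- `q_i = min {q > 0 | q β_i ∈ G_{i-1}}`, for `i ≥ 1`. -/
def qIdx (β : ℕ → ℚ) (i : ℕ) : ℕ := sInf {q : ℕ | 0 < q ∧ q * β i ∈ groupG β (i - 1)}

/-- `s_i = min {s > 0 | s γ_i ∈ H_{i-1} + G}`, for `i ≥ 1`. -/
def sIdx (β γ : ℕ → ℚ) (i : ℕ) : ℕ :=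
  sInf {s : ℕ | 0 < s ∧ s * γ i ∈ groupH γ (i - 1) ⊔ groupGUnion β}

/-- `m_0 = 0` and `m_i = max (m_{i-1}, min {j ≥ 0 | s_i γ_i ∈ H_{i-1} + G_j})`. -/
def mIdx (β γ : ℕ → ℚ) : ℕ → ℕ
  | 0 => 0
  | i + 1 => max (mIdx β γ i)
      (sInf {j : ℕ | sIdx β γ (i + 1) * γ (i + 1) ∈ groupH γ i ⊔ groupG β j})

/-- The exponents of the defining polynomials: for `i ≥ 1` the coefficients of the normal forms
`q_i β_i = ∑_{j < i} n_{i,j} β_j` and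
`s_i γ_i = a_i β_0 + ∑_{1 ≤ j ≤ m_i} n̄_{i,j} β_j + ∑_{1 ≤ j < i} l_{i,j} γ_j`. -/
structure DefiningExponents (β γ : ℕ → ℚ) where
  n : ℕ → ℕ → ℕ
  a : ℕ → ℤ
  nbar : ℕ → ℕ → ℕ
  l : ℕ → ℕ → ℕ
  n_lt : ∀ i j, 1 ≤ j → j < i → n i j < qIdx β j
  n_sum : ∀ i, 1 ≤ i → qIdx β i * β i = ∑ j ∈ Finset.range i, n i j * β j
  nbar_lt : ∀ i j, 1 ≤ i → 1 ≤ j → j ≤ mIdx β γ i → nbar i j < qIdx β j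
  l_lt : ∀ i j, 1 ≤ j → j < i → l i j < sIdx β γ j
  s_sum : ∀ i, 1 ≤ i → sIdx β γ i * γ i =
    a i * β 0 + ∑ j ∈ Finset.Icc 1 (mIdx β γ i), nbar i j * β j
      + ∑ j ∈ Finset.Ico 1 i, l i j * γ j

/-- `r_{i,0} = max (0, -a_i)`. -/
def DefiningExponents.r {β γ : ℕ → ℚ} (e : DefiningExponents β γ) (i : ℕ) : ℕ := (-e.a i).toNat

/-- `n̄_{i,0} = max (0, a_i)`. -/
def DefiningExponents.nbarZero {β γ : ℕ → ℚ} (e : DefiningExponents β γ) (i : ℕ) : ℕ :=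
  (e.a i).toNat

/-- The conditions under which the numerical data determine a valuation. -/
structure DefiningExponents.Admissible {β γ : ℕ → ℚ} (e : DefiningExponents β γ) : Prop where
  β_pos : ∀ i, 0 < β i
  γ_pos : ∀ i, 1 ≤ i → 0 < γ i
  β_growth : ∀ i, 1 ≤ i → qIdx β i * β i < β (i + 1)
  γ_growth : ∀ i, 1 ≤ i → e.r i * β 0 + sIdx β γ i * γ i < γ (i + 1)
  q_infinite : {i | 1 ≤ i ∧ 1 < qIdx β i}.Infinite
  s_infinite : {i | 1 ≤ i ∧ 1 < sIdx β γ i}.Infinite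

/-- `P_0, P_1, …` and `Q_1, Q_2, …` are the defining polynomials attached to the numerical data and
to the residues `lam i` and `mu i` (`i ≥ 1`). -/
structure IsDefiningSequence {k : Type*} [Field k] {β γ : ℕ → ℚ} (e : DefiningExponents β γ)
    (lam mu : ℕ → k) (P Q : ℕ → Poly k) : Prop where
  P_zero : P 0 = X 0
  P_one : P 1 = X 1
  Q_one : Q 1 = X 2
  P_succ : ∀ i, 1 ≤ i →
    P (i + 1) = P i ^ qIdx β i - C (lam i) * ∏ j ∈ Finset.range i, P j ^ e.n i j
  Q_succ : ∀ i, 1 ≤ i →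
    Q (i + 1) = X 0 ^ e.r i * Q i ^ sIdx β γ i
      - C (mu i) * (P 0 ^ e.nbarZero i * ∏ j ∈ Finset.Icc 1 (mIdx β γ i), P j ^ e.nbar i j)
        * ∏ j ∈ Finset.Ico 1 i, Q j ^ e.l i j

/-- `ν` is the valuation determined by the data: it dominates `k[x, y, z]_{(x, y, z)}` and takes the
prescribed values on the defining polynomials. -/
def HasDefiningData {k : Type*} [Field k] (β γ : ℕ → ℚ) (P Q : ℕ → Poly k)
    (ν : AddValuation (RatFun k) (WithTop ℚ)) : Prop :=
  Dominates ν (localRing k) ∧ (∀ i, polyVal ν (P i) = (β i : WithTop ℚ)) ∧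
    ∀ i, 1 ≤ i → polyVal ν (Q i) = (γ i : WithTop ℚ)

/-! ### The data of the example -/

/-- `1, 3/2, 13/4, 53/8, …`: `β_i = 2 β_{i-1} + 1 / 2 ^ i` for `i ≥ 2`. -/
def exβ : ℕ → ℚ
  | 0 => 1
  | 1 => 3 / 2
  | i + 2 => 2 * exβ (i + 1) + 1 / 2 ^ (i + 2)

/-- `γ_1, γ_2, … = 9/4, 13/3, 118/9, …`: `γ_{i+1} = 3 γ_i + 1 / 3 ^ i` for `i ≥ 2`. The entry at `0`
is a placeholder. -/
def exγ : ℕ → ℚ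
  | 0 => 0
  | 1 => 9 / 4
  | 2 => 13 / 3
  | i + 3 => 3 * exγ (i + 2) + 1 / 3 ^ (i + 2)

/-- `P_0 = x`, `P_1 = y`, `P_2 = y² - x³`, and `P_i = P_{i-1}² - x^(5·2^(i-3)) P_{i-2}` for
`i ≥ 3`. -/
def exP (k : Type*) [Field k] : ℕ → Poly k
  | 0 => X 0
  | 1 => X 1
  | 2 => X 1 ^ 2 - X 0 ^ 3
  | i + 3 => exP k (i + 2) ^ 2 - X 0 ^ (5 * 2 ^ i) * exP k (i + 1)

/-- `Q_1 = z`, `Q_2 = x z - P_2`, `Q_3 = Q_2³ - x¹³`, and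
`Q_{i+1} = Q_i³ - x^(35·3^(i-3)) Q_{i-1}` for `i ≥ 3`. The entry at `0` is a placeholder. -/
def exQ (k : Type*) [Field k] : ℕ → Poly k
  | 0 => 0
  | 1 => X 2
  | 2 => X 0 * X 2 - exP k 2
  | 3 => exQ k 2 ^ 3 - X 0 ^ 13
  | i + 4 => exQ k (i + 3) ^ 3 - X 0 ^ (35 * 3 ^ i) * exQ k (i + 2)

/-- `R_1 = Q_1` and `R_i = R_{i-1}² - x^(3·2^(i-2)) P_{i-1}` for `i ≥ 2`. The entry at `0` is a
placeholder. -/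
def exR (k : Type*) [Field k] : ℕ → Poly k
  | 0 => 0
  | 1 => exQ k 1
  | i + 2 => exR k (i + 1) ^ 2 - X 0 ^ (3 * 2 ^ i) * exP k (i + 1)

end ValSemigroup

end

noncomputable section

namespace ValSemigroup

/-! ### The numerical data -/

/-! Call a monomial in the generators `x`, `y`, `Q_{j+2}`, `R_{i+1}` a word, and give it the sum of
the prescribed values of its letters. The recursions let one replace `y²`, `Q_{j+2}³` and `R_{i+1}²`
by a word of the same value plus words of larger value. A weight decreases in all terms at once, so
rewriting terminates: modulo standard words of strictly larger value, every word is one standard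
word of the same value, with coefficient 1 (`Word.exists_isStandard`). Standard means exponent at
most 1 on `y` and on each `R`, at most 2 on each `Q`.

The only relation that is not immediate is the one for `R_{i+2}²`, which involves `P_{i+2}`, not a
generator. There `P_{i+2} = x^(2^i) R_{i+1}` up to a correction of larger value and controlled
weight (`correction_mem`).

Two facts make standard words behave like monomials. Their values are distinct, by uniqueness of
digits: base 3 in the denominators of the `Q` values, base 2 in those of the `R` values
(`Word.IsStandard.val_injective`). They are linearly independent: their top monomials for the degree
in `y` and `z` are distinct, again by digits (`linearIndependent_standard`).

Hence every nonzero polynomial has a leading word. A product of leading words is a word, and it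
survives modulo words of larger value, so the value of the leading word is a valuation. Conversely,
the data force the value of each correction, hence of each `R`, each word and each polynomial; this
gives uniqueness. The values of polynomials are exactly the values of words, which gives the
semigroup. -/

theorem two_mul_exβ_one : 2 * exβ 1 = 3 * exβ 0 := by norm_num [exβ]

/-- Equality of the values of the two terms whose difference is `P_{i+3}`; the linear recursion for
`β` propagates it from the first case. -/
theorem two_mul_exβ (i : ℕ) : 2 * exβ (i + 2) = 5 * 2 ^ i + exβ (i + 1) := by
  induction i with
  | zero => norm_num [exβ]
  | succ i ih =>
    have h₁ : exβ (i + 1 + 2) = 2 * exβ (i + 2) + 1 / 2 ^ (i + 3) := by rw [exβ]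
    have h₂ : exβ (i + 2) = 2 * exβ (i + 1) + 1 / 2 ^ (i + 2) := by rw [exβ]
    linear_combination 2 * h₁ + 2 * ih - h₂

theorem three_mul_exγ_two : 3 * exγ 2 = 13 := by norm_num [exγ]

theorem three_mul_exγ (i : ℕ) : 3 * exγ (i + 3) = 35 * 3 ^ i + exγ (i + 2) := by
  induction i with
  | zero => norm_num [exγ]
  | succ i ih =>
    have h₁ : exγ (i + 1 + 3) = 3 * exγ (i + 3) + 1 / 3 ^ (i + 3) := by rw [exγ]
    have h₂ : exγ (i + 3) = 3 * exγ (i + 2) + 1 / 3 ^ (i + 2) := by rw [exγ]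
    linear_combination 3 * h₁ + 3 * ih - h₂

theorem exβ_pos (i : ℕ) : 0 < exβ i := by
  induction i with
  | zero => norm_num [exβ]
  | succ i ih =>
    cases i with
    | zero => norm_num [exβ]
    | succ i => rw [exβ]; positivity

theorem exγ_pos (i : ℕ) : 0 < exγ (i + 1) := by
  induction i with
  | zero => norm_num [exγ]
  | succ i ih =>
    cases i with
    | zero => norm_num [exγ]
    | succ i => rw [exγ]; positivity

theorem two_mul_exβ_lt (i : ℕ) : 2 * exβ (i + 1) < exβ (i + 2) := by
  rw [exβ]
  linarith [show (0 : ℚ) < 1 / 2 ^ (i + 2) by positivity]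

theorem three_mul_exγ_lt (i : ℕ) : 3 * exγ (i + 2) < exγ (i + 3) := by
  rw [exγ]
  linarith [show (0 : ℚ) < 1 / 3 ^ (i + 2) by positivity]

theorem two_pow_lt_exβ (i : ℕ) : 2 ^ i < exβ (i + 2) := by
  induction i with
  | zero => norm_num [exβ]
  | succ i ih => rw [pow_succ]; linarith [two_mul_exβ_lt (i + 1)]

/-- The recursion turns an odd numerator `n` over `2^(i+1)` into `4n + 1` over `2^(i+2)`, so each
step adds exactly one factor 2 to the denominator. -/
theorem exβ_eq_odd_div (i : ℕ) : ∃ n : ℤ, ¬ (2 : ℤ) ∣ n ∧ exβ i = n / 2 ^ i := by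
  induction i with
  | zero => exact ⟨1, by norm_num, by norm_num [exβ]⟩
  | succ i ih =>
    cases i with
    | zero => exact ⟨3, by norm_num, by norm_num [exβ]⟩
    | succ i =>
      obtain ⟨n, hn, h⟩ := ih
      refine ⟨4 * n + 1, by omega, ?_⟩
      rw [exβ, h]
      push_cast
      field_simp
      ring

theorem exγ_eq_div (i : ℕ) : ∃ n : ℤ, ¬ (3 : ℤ) ∣ n ∧ exγ (i + 2) = n / 3 ^ (i + 1) := by
  induction i with
  | zero => exact ⟨13, by norm_num, by norm_num [exγ]⟩
  | succ i ih =>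
    obtain ⟨n, hn, h⟩ := ih
    refine ⟨9 * n + 1, by omega, ?_⟩
    rw [exγ, h]
    push_cast
    field_simp
    ring

/-! ### The `p`-adic norms of the data -/

theorem padicNorm_self_pow (p : ℕ) [Fact p.Prime] (i : ℕ) :
    padicNorm p ((p : ℚ) ^ i) = ((p : ℚ) ^ i)⁻¹ := by
  induction i with
  | zero => simp
  | succ i ih => rw [pow_succ, padicNorm.mul, ih, padicNorm.padicNorm_p_of_prime, mul_inv]

theorem padicNorm_div_pow {p : ℕ} [Fact p.Prime] {n : ℤ} (hn : ¬ (p : ℤ) ∣ n) (i : ℕ) :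
    padicNorm p (n / (p : ℚ) ^ i) = p ^ i := by
  rw [padicNorm.div, padicNorm_self_pow, (padicNorm.int_eq_one_iff n).2 hn, one_div, inv_inv]

theorem padicNorm_two_exβ (i : ℕ) : padicNorm 2 (exβ i) = 2 ^ i := by
  obtain ⟨n, hn, h⟩ := exβ_eq_odd_div i
  rw [h]
  exact_mod_cast padicNorm_div_pow (p := 2) (by exact_mod_cast hn) i

theorem padicNorm_three_exγ (i : ℕ) : padicNorm 3 (exγ (i + 2)) = 3 ^ (i + 1) := by
  obtain ⟨n, hn, h⟩ := exγ_eq_div i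
  rw [h]
  exact_mod_cast padicNorm_div_pow (p := 3) (by exact_mod_cast hn) (i + 1)

theorem padicNorm_three_exβ_le (i : ℕ) : padicNorm 3 (exβ i) ≤ 1 := by
  obtain ⟨n, -, h⟩ := exβ_eq_odd_div i
  have h2 : padicNorm 3 ((2 : ℕ) : ℚ) = 1 := (padicNorm.nat_eq_one_iff 2).2 (by norm_num)
  have hpow : padicNorm 3 ((2 : ℚ) ^ i) = 1 := by
    clear h
    induction i with
    | zero => simp
    | succ i ih => rw [pow_succ, padicNorm.mul, ih, one_mul]; exact_mod_cast h2
  rw [h, padicNorm.div, hpow, div_one]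
  exact padicNorm.of_int n

/-- The elements of `ℚ` of `p`-adic norm at most `r`. -/
def padicBall (p : ℕ) [Fact p.Prime] (r : ℚ) (hr : 0 ≤ r) : AddSubgroup ℚ where
  carrier := {q | padicNorm p q ≤ r}
  zero_mem' := by simpa using hr
  add_mem' := fun ha hb => padicNorm.nonarchimedean.trans (max_le ha hb)
  neg_mem' := fun {a} ha => by simpa using ha

/-- Ultrametric principle: a strictly dominant term cannot be cancelled. This is what turns digit
bounds into uniqueness of representations. -/
theorem sum_ne_zero_of_padicNorm_lt {ι : Type*} {p : ℕ} [Fact p.Prime] {S : Finset ι}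
    {f : ι → ℚ} {l : ι} (hl : l ∈ S) (hf : f l ≠ 0)
    (h : ∀ l' ∈ S, l' ≠ l → padicNorm p (f l') < padicNorm p (f l)) : ∑ i ∈ S, f i ≠ 0 := by
  classical
  intro h0
  rw [← Finset.add_sum_erase S f hl] at h0
  have hlt : padicNorm p (∑ i ∈ S.erase l, f i) < padicNorm p (f l) := by
    apply padicNorm.sum_lt'
    · intro i hi
      exact h i (Finset.mem_of_mem_erase hi) (Finset.ne_of_mem_erase hi)
    · exact lt_of_le_of_ne (padicNorm.nonneg _) (Ne.symm (padicNorm.nonzero hf))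
  rw [eq_neg_of_add_eq_zero_left h0, padicNorm.neg] at hlt
  exact lt_irrefl _ hlt

/-! ### The attached indices -/

theorem groupG_le_padicBall (i : ℕ) : groupG exβ i ≤ padicBall 2 (2 ^ i) (by positivity) := by
  rw [groupG, AddSubgroup.closure_le]
  rintro _ ⟨j, hj, rfl⟩
  change padicNorm 2 (exβ j) ≤ 2 ^ i
  rw [padicNorm_two_exβ]
  exact pow_le_pow_right₀ (by norm_num) hj

theorem exβ_mem_groupG {i j : ℕ} (h : j ≤ i) : exβ j ∈ groupG exβ i :=
  AddSubgroup.subset_closure ⟨j, h, rfl⟩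

theorem natCast_mem_groupG (n i : ℕ) : (n : ℚ) ∈ groupG exβ i := by
  have := nsmul_mem (exβ_mem_groupG (Nat.zero_le i)) n
  simpa [exβ] using this

theorem two_mul_exβ_mem (i : ℕ) : 2 * exβ (i + 1) ∈ groupG exβ i := by
  cases i with
  | zero =>
    rw [two_mul_exβ_one]
    simpa [exβ] using natCast_mem_groupG 3 0
  | succ i =>
    rw [two_mul_exβ]
    refine add_mem ?_ (exβ_mem_groupG le_rfl)
    simpa using natCast_mem_groupG (5 * 2 ^ i) (i + 1)

/-- The relation for `2β` bounds the index above; below, `G_i` lies in the 2-adic ball of radius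
`2^i`, which misses `β_{i+1}`. -/
theorem qIdx_exβ (i : ℕ) : qIdx exβ (i + 1) = 2 := by
  have h2 : 2 ∈ {q : ℕ | 0 < q ∧ q * exβ (i + 1) ∈ groupG exβ (i + 1 - 1)} :=
    ⟨by norm_num, by simpa using two_mul_exβ_mem i⟩
  refine le_antisymm (Nat.sInf_le h2) (le_csInf ⟨2, h2⟩ ?_)
  rintro q ⟨hq, hmem⟩
  by_contra hlt
  obtain rfl : q = 1 := by omega
  have h := groupG_le_padicBall _ hmem
  change padicNorm 2 _ ≤ 2 ^ i at h
  rw [Nat.cast_one, one_mul, padicNorm_two_exβ] at h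
  exact absurd h (not_le.2 (pow_lt_pow_right₀ (by norm_num) (Nat.lt_succ_self i)))

theorem groupGUnion_le_padicBall (r : ℚ) (hr : 1 ≤ r) :
    groupGUnion exβ ≤ padicBall 3 r (zero_le_one.trans hr) := by
  rw [groupGUnion, AddSubgroup.closure_le]
  rintro _ ⟨j, rfl⟩
  exact (padicNorm_three_exβ_le j).trans hr

theorem exγ_one_eq : exγ 1 = exβ 2 - exβ 0 := by norm_num [exγ, exβ]

theorem groupH_sup_le_padicBall (i : ℕ) :
    groupH exγ (i + 1) ⊔ groupGUnion exβ ≤ padicBall 3 (3 ^ i) (by positivity) := by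
  refine sup_le ?_ (groupGUnion_le_padicBall _ (one_le_pow₀ (by norm_num)))
  rw [groupH, AddSubgroup.closure_le]
  rintro _ ⟨j, ⟨hj, hji⟩, rfl⟩
  -- The generator `γ_1 = β_2 - β_0` is 3-integral and follows no 3-adic pattern, so it is treated
  -- apart.
  obtain rfl | hj1 := hj.eq_or_lt
  · rw [exγ_one_eq]
    exact sub_mem (groupGUnion_le_padicBall _ (one_le_pow₀ (by norm_num))
      (AddSubgroup.subset_closure ⟨2, rfl⟩)) (groupGUnion_le_padicBall _
      (one_le_pow₀ (by norm_num)) (AddSubgroup.subset_closure ⟨0, rfl⟩))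
  · obtain ⟨m, rfl⟩ : ∃ m, j = m + 2 := ⟨j - 2, by omega⟩
    change padicNorm 3 (exγ (m + 2)) ≤ 3 ^ i
    rw [padicNorm_three_exγ]
    exact pow_le_pow_right₀ (by norm_num) (by omega)

theorem groupG_le_groupGUnion (i : ℕ) : groupG exβ i ≤ groupGUnion exβ :=
  AddSubgroup.closure_mono (Set.image_subset_range _ _)

theorem three_mul_exγ_mem (i j : ℕ) : 3 * exγ (i + 2) ∈ groupH exγ (i + 1) ⊔ groupG exβ j := by
  cases i with
  | zero =>
    rw [three_mul_exγ_two]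
    exact AddSubgroup.mem_sup_right (by simpa using natCast_mem_groupG 13 j)
  | succ i =>
    rw [three_mul_exγ]
    refine add_mem (AddSubgroup.mem_sup_right ?_)
      (AddSubgroup.mem_sup_left
        (AddSubgroup.subset_closure ⟨i + 2, ⟨by simp, by simp⟩, rfl⟩))
    simpa using natCast_mem_groupG (35 * 3 ^ i) j

theorem sIdx_one : sIdx exβ exγ 1 = 1 := by
  have h1 : 1 ∈ {s : ℕ | 0 < s ∧ s * exγ 1 ∈ groupH exγ (1 - 1) ⊔ groupGUnion exβ} := by
    refine ⟨one_pos, AddSubgroup.mem_sup_right ?_⟩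
    rw [Nat.cast_one, one_mul, exγ_one_eq]
    exact sub_mem (AddSubgroup.subset_closure ⟨2, rfl⟩) (AddSubgroup.subset_closure ⟨0, rfl⟩)
  exact le_antisymm (Nat.sInf_le h1) (le_csInf ⟨1, h1⟩ fun s hs => hs.1)

theorem sIdx_add_two (i : ℕ) : sIdx exβ exγ (i + 2) = 3 := by
  have h3 : 3 ∈ {s : ℕ | 0 < s ∧ s * exγ (i + 2) ∈ groupH exγ (i + 2 - 1) ⊔ groupGUnion exβ} :=
    ⟨by norm_num, sup_le_sup_left (groupG_le_groupGUnion 0) _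
      (by simpa using three_mul_exγ_mem i 0)⟩
  refine le_antisymm (Nat.sInf_le h3) (le_csInf ⟨3, h3⟩ ?_)
  rintro s ⟨hs, hmem⟩
  by_contra hlt
  have h := groupH_sup_le_padicBall _ hmem
  change padicNorm 3 _ ≤ 3 ^ i at h
  rw [padicNorm.mul, padicNorm_three_exγ, (padicNorm.nat_eq_one_iff s).2, one_mul] at h
  · exact absurd h (not_le.2 (pow_lt_pow_right₀ (by norm_num) (Nat.lt_succ_self i)))
  · intro hd
    have := Nat.le_of_dvd hs hd
    omega

/-- `γ_1 = 9/4` has 2-adic norm 4, so it needs `β_2`. Every later `3γ_i` already lies in `H_{i-1} +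
G_0`, so the maximum stays at 2. -/
theorem mIdx_succ (i : ℕ) : mIdx exβ exγ (i + 1) = 2 := by
  induction i with
  | zero =>
    have h0 : groupH exγ 0 = ⊥ := by
      rw [groupH, AddSubgroup.closure_eq_bot_iff]
      rintro _ ⟨j, ⟨hj, hj'⟩, -⟩
      omega
    rw [mIdx, mIdx, Nat.zero_max, zero_add, sIdx_one, h0]
    simp only [bot_sup_eq, Nat.cast_one, one_mul]
    have h2 : 2 ∈ {j : ℕ | exγ 1 ∈ groupG exβ j} := by
      change exγ 1 ∈ groupG exβ 2
      rw [exγ_one_eq]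
      exact sub_mem (exβ_mem_groupG le_rfl) (exβ_mem_groupG (by norm_num))
    refine le_antisymm (Nat.sInf_le h2) (le_csInf ⟨2, h2⟩ ?_)
    intro j hj
    by_contra hlt
    have h := groupG_le_padicBall _ hj
    change padicNorm 2 _ ≤ 2 ^ j at h
    have h9 : padicNorm 2 (exγ 1) = 2 ^ 2 := by
      have := padicNorm_div_pow (p := 2) (n := 9) (by norm_num) 2
      rw [exγ]
      norm_num at this ⊢
      exact this
    rw [h9] at h
    exact absurd h (not_le.2 (pow_lt_pow_right₀ (by norm_num) (by omega)))
  | succ i ih =>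
    rw [mIdx, ih, sIdx_add_two]
    apply max_eq_left
    have h0 : 0 ∈ {j : ℕ | ((3 : ℕ) : ℚ) * exγ (i + 1 + 1) ∈ groupH exγ (i + 1) ⊔ groupG exβ j} := by
      simpa using three_mul_exγ_mem i 0
    exact (Nat.sInf_le h0).trans (by norm_num)

/-- The exponents of the defining polynomials of the example. -/
def exExponents : DefiningExponents exβ exγ where
  n i j := if j = 0 then (if i = 1 then 3 else 5 * 2 ^ (i - 2)) else if j + 1 = i then 1 else 0
  a i := if i = 1 then -1 else if i = 2 then 13 else 35 * 3 ^ (i - 3)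
  nbar i j := if i = 1 ∧ j = 2 then 1 else 0
  l i j := if 3 ≤ i ∧ j + 1 = i then 1 else 0
  n_lt i j hj hji := by
    obtain ⟨m, rfl⟩ : ∃ m, j = m + 1 := ⟨j - 1, by omega⟩
    rw [qIdx_exβ, if_neg (by omega)]
    split_ifs <;> omega
  n_sum i hi := by
    obtain ⟨m, rfl⟩ : ∃ m, i = m + 1 := ⟨i - 1, by omega⟩
    rw [qIdx_exβ]
    cases m with
    | zero => norm_num [exβ]
    | succ m =>
      rw [Nat.cast_two, two_mul_exβ, Finset.sum_range_succ, Finset.sum_range_succ',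
        Finset.sum_eq_zero]
      · simp [exβ]
      · intro j hj
        rw [Finset.mem_range] at hj
        rw [if_neg (by omega), if_neg (by omega)]
        simp
  nbar_lt i j _ hj hjm := by
    obtain ⟨m, rfl⟩ : ∃ m, j = m + 1 := ⟨j - 1, by omega⟩
    rw [qIdx_exβ]
    split_ifs <;> omega
  l_lt i j hj hji := by
    obtain ⟨m, rfl⟩ : ∃ m, j = m + 1 := ⟨j - 1, by omega⟩
    cases m with
    | zero => rw [sIdx_one, if_neg (by omega)]; norm_num
    | succ m => rw [sIdx_add_two]; split_ifs <;> omega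
  s_sum i hi := by
    obtain ⟨m, rfl⟩ : ∃ m, i = m + 1 := ⟨i - 1, by omega⟩
    rw [mIdx_succ, show Finset.Icc 1 2 = ({1, 2} : Finset ℕ) by rfl]
    match m with
    | 0 => norm_num [sIdx_one, exγ, exβ]
    | 1 =>
      rw [sIdx_add_two]
      norm_num [exγ, exβ]
    | m + 2 =>
      rw [sIdx_add_two, Nat.cast_ofNat, three_mul_exγ, Finset.sum_eq_single (m + 2)]
      · simp [exβ]
      · intro j _ hj
        rw [if_neg (by omega)]
        simp
      · simp

theorem exExponents_r (i : ℕ) : exExponents.r i = if i = 1 then 1 else 0 := by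
  simp only [DefiningExponents.r, exExponents]
  split_ifs
  · rfl
  · rfl
  · rw [Int.toNat_eq_zero, Left.neg_nonpos_iff]; positivity

theorem exExponents_admissible : exExponents.Admissible where
  β_pos := exβ_pos
  γ_pos i hi := by
    obtain ⟨m, rfl⟩ : ∃ m, i = m + 1 := ⟨i - 1, by omega⟩
    exact exγ_pos m
  β_growth i hi := by
    obtain ⟨m, rfl⟩ : ∃ m, i = m + 1 := ⟨i - 1, by omega⟩
    rw [qIdx_exβ]
    exact_mod_cast two_mul_exβ_lt m
  γ_growth i hi := by
    obtain ⟨m, rfl⟩ : ∃ m, i = m + 1 := ⟨i - 1, by omega⟩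
    rw [exExponents_r]
    cases m with
    | zero => rw [sIdx_one]; norm_num [exγ, exβ]
    | succ m => rw [sIdx_add_two]; simpa using three_mul_exγ_lt m
  q_infinite := by
    refine (Set.Ici_infinite 1).mono fun i hi => ?_
    obtain ⟨m, rfl⟩ : ∃ m, i = m + 1 := ⟨i - 1, by simp at hi; omega⟩
    exact ⟨by omega, by rw [qIdx_exβ]; norm_num⟩
  s_infinite := by
    refine (Set.Ici_infinite 2).mono fun i hi => ?_
    obtain ⟨m, rfl⟩ : ∃ m, i = m + 2 := ⟨i - 2, by simp at hi; omega⟩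
    exact ⟨by omega, by rw [sIdx_add_two]; norm_num⟩

theorem exExponents_isDefiningSequence (k : Type*) [Field k] :
    IsDefiningSequence exExponents (fun _ => (1 : k)) (fun _ => (1 : k)) (exP k) (exQ k) where
  P_zero := rfl
  P_one := rfl
  Q_one := rfl
  P_succ i hi := by
    obtain ⟨m, rfl⟩ : ∃ m, i = m + 1 := ⟨i - 1, by omega⟩
    rw [qIdx_exβ]
    cases m with
    | zero => simp [exP, exExponents]
    | succ m =>
      rw [Finset.prod_range_succ, Finset.prod_range_succ', Finset.prod_eq_one]
      · simp [exP, exExponents]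
      · intro j hj
        rw [Finset.mem_range] at hj
        simp only [exExponents]
        rw [if_neg (by omega), if_neg (by omega), pow_zero]
  Q_succ i hi := by
    rw [exExponents_r]
    obtain ⟨m, rfl⟩ : ∃ m, i = m + 1 := ⟨i - 1, by omega⟩
    rw [mIdx_succ, show Finset.Icc 1 2 = ({1, 2} : Finset ℕ) by rfl]
    match m with
    | 0 => simp [sIdx_one, exQ, exExponents, DefiningExponents.nbarZero]
    | 1 =>
      rw [sIdx_add_two]
      simp [exQ, exP, exExponents, DefiningExponents.nbarZero]
    | m + 2 =>
      rw [sIdx_add_two, Finset.prod_eq_single (s := Finset.Ico 1 _) (m + 2)]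
      · have h : ((35 : ℤ) * 3 ^ m).toNat = 35 * 3 ^ m := by
          rw [show ((35 : ℤ) * 3 ^ m) = ((35 * 3 ^ m : ℕ) : ℤ) by push_cast; rfl, Int.toNat_natCast]
        simp [exQ, exP, exExponents, DefiningExponents.nbarZero, h]
      · intro j _ hj
        simp only [exExponents]
        rw [if_neg (by omega), pow_zero]
      · intro h
        simp at h

/-! ### Words in the generators -/

/-- The generators `x`, `y`, `Q_{j+2}` and `R_{i+1}` of the value semigroup. -/
inductive Letter : Type
  | x : Letter
  | y : Letter
  | q (j : ℕ) : Letter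
  | r (i : ℕ) : Letter

namespace Letter

/-- The value of a generator. -/
def val : Letter → ℚ
  | x => 1
  | y => 3 / 2
  | q j => exγ (j + 2)
  | r i => exβ (i + 2) - 2 ^ i

/-- A weight that drops along the straightening relations. -/
def measure : Letter → ℕ
  | x => 0
  | y => 2
  | q j => 2 * 3 ^ j + 1
  | r i => 2 ^ i + 1

/-- The largest exponent of a generator in a standard word. -/
def cap : Letter → ℕ∞
  | x => ⊤
  | y => 1
  | q _ => 2
  | r _ => 1

/-- The polynomial of a generator. -/
def poly (k : Type*) [Field k] : Letter → Poly k
  | x => X 0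
  | y => X 1
  | q j => exQ k (j + 2)
  | r i => exR k (i + 1)

theorem val_pos (l : Letter) : 0 < l.val := by
  cases l with
  | x => norm_num [val]
  | y => norm_num [val]
  | q j => exact exγ_pos _
  | r i => exact sub_pos.2 (two_pow_lt_exβ i)

end Letter

/-- Commutative words in the generators. -/
abbrev Word := Letter →₀ ℕ

namespace Word

/-- The value of a word. -/
def val : Word →+ ℚ := Finsupp.weight Letter.val

/-- The weight of a word that drops along the straightening relations. -/
def measure : Word →+ ℕ := Finsupp.weight Letter.measure

/-- A word is standard if no straightening relation applies. -/
def IsStandard (w : Word) : Prop := ∀ l, (w l : ℕ∞) ≤ l.cap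

/-- The polynomial of a word. -/
def poly (k : Type*) [Field k] (w : Word) : Poly k := w.prod fun l n => l.poly k ^ n

theorem IsStandard.le {w : Word} (hw : w.IsStandard) {l : Letter} {n : ℕ} (hl : l.cap = n) :
    w l ≤ n := by
  exact_mod_cast hl ▸ hw l

@[simp] theorem val_single (l : Letter) (n : ℕ) : val (Finsupp.single l n) = n * l.val := by
  simp [val, Finsupp.weight_single]

@[simp] theorem measure_single (l : Letter) (n : ℕ) :
    measure (Finsupp.single l n) = n * l.measure := by
  simp [measure, Finsupp.weight_single]

theorem val_nonneg (w : Word) : 0 ≤ val w := by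
  rw [val, Finsupp.weight_apply]
  exact Finset.sum_nonneg fun l _ => nsmul_nonneg l.val_pos.le _

variable {k : Type*} [Field k]

@[simp] theorem poly_zero : poly k 0 = 1 := Finsupp.prod_zero_index

@[simp] theorem poly_single (l : Letter) (n : ℕ) :
    poly k (Finsupp.single l n) = l.poly k ^ n :=
  Finsupp.prod_single_index (pow_zero _)

theorem poly_add (w w' : Word) : poly k (w + w') = poly k w * poly k w' := by
  classical
  exact Finsupp.prod_add_index' (fun _ => pow_zero _) fun _ _ _ => pow_add _ _ _

end Word

/-- The span of the words satisfying a condition. -/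
def wordSpan (k : Type*) [Field k] (p : Word → Prop) : Submodule k (Poly k) :=
  Submodule.span k (Word.poly k '' {w | p w})

section wordSpan

variable {k : Type*} [Field k]

theorem poly_mem_wordSpan {p : Word → Prop} {w : Word} (h : p w) : w.poly k ∈ wordSpan k p :=
  Submodule.subset_span ⟨w, h, rfl⟩

theorem wordSpan_le {p : Word → Prop} {N : Submodule k (Poly k)}
    (h : ∀ w, p w → w.poly k ∈ N) : wordSpan k p ≤ N := by
  rw [wordSpan, Submodule.span_le]
  rintro _ ⟨w, hw, rfl⟩
  exact h w hw

theorem wordSpan_mono {p p' : Word → Prop} (h : ∀ w, p w → p' w) :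
    wordSpan k p ≤ wordSpan k p' :=
  wordSpan_le fun w hw => poly_mem_wordSpan (h w hw)

theorem mul_mem_wordSpan {p p' p'' : Word → Prop} (h : ∀ w w', p w → p' w' → p'' (w + w'))
    {f g : Poly k} (hf : f ∈ wordSpan k p) (hg : g ∈ wordSpan k p') :
    f * g ∈ wordSpan k p'' := by
  have hfg := Submodule.mul_mem_mul hf hg
  rw [wordSpan, wordSpan, Submodule.span_mul_span] at hfg
  refine Submodule.span_le.2 ?_ hfg
  rintro _ ⟨_, ⟨w, hw, rfl⟩, _, ⟨w', hw', rfl⟩, rfl⟩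
  change w.poly k * w'.poly k ∈ _
  rw [← Word.poly_add]
  exact poly_mem_wordSpan (h w w' hw hw')

/-! ### The straightening relations -/

/-- The difference between `x ^ (2 ^ i) R_{i+1}` and `P_{i+2}`. -/
def correction (k : Type*) [Field k] (i : ℕ) : Poly k :=
  X 0 ^ 2 ^ i * exR k (i + 1) - exP k (i + 2)

theorem correction_zero : correction k 0 = exQ k 2 := by
  simp [correction, exR, exQ]

/-- The tails `x^(5·2^i) P_{i+1}` cancel and a difference of squares remains. This form suits
valuations for which the value of `P` is given; the next one eliminates `P` in favour of letters. -/
theorem correction_succ (i : ℕ) :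
    correction k (i + 1) = correction k i * (2 * exP k (i + 2) + correction k i) := by
  simp only [correction, exR, exP]
  ring

theorem correction_succ' (i : ℕ) :
    correction k (i + 1) =
      correction k i * (2 * (X 0 ^ 2 ^ i * exR k (i + 1)) - correction k i) := by
  rw [correction_succ]
  simp only [correction]
  ring

/-- Both factors of the recursion have weight at most `2^(i+2)`, so the bound doubles; the value
excess over `β` halves because `β` itself more than doubles. -/
theorem correction_mem (i : ℕ) : correction k i ∈
    wordSpan k fun w => exβ (i + 2) + 1 / 2 ^ (i + 2) ≤ w.val ∧ w.measure ≤ 2 ^ (i + 2) := by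
  induction i with
  | zero =>
    rw [correction_zero]
    have h : Word.poly k (Finsupp.single (Letter.q 0) 1) = exQ k 2 := by simp [Letter.poly]
    rw [← h]
    apply poly_mem_wordSpan
    norm_num [Letter.val, Letter.measure, exβ, exγ]
  | succ i ih =>
    rw [correction_succ']
    have hβ : exβ (i + 1 + 2) + 1 / 2 ^ (i + 1 + 2) =
        exβ (i + 2) + 1 / 2 ^ (i + 2) + exβ (i + 2) := by
      rw [exβ]; ring
    refine mul_mem_wordSpan (p' := fun w => exβ (i + 2) ≤ w.val ∧ w.measure ≤ 2 ^ (i + 2)) ?_ ih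
      (sub_mem ?_ (wordSpan_mono ?_ ih))
    · rintro w w' ⟨h1, h2⟩ ⟨h3, h4⟩
      rw [map_add, map_add, hβ, pow_succ 2 (i + 2)]
      exact ⟨add_le_add h1 h3, by omega⟩
    · have h : Word.poly k (Finsupp.single Letter.x (2 ^ i) + Finsupp.single (Letter.r i) 1) =
          X 0 ^ 2 ^ i * exR k (i + 1) := by
        simp [Word.poly_add, Letter.poly]
      rw [← h, two_mul]
      have hm : Word.poly k (Finsupp.single Letter.x (2 ^ i) + Finsupp.single (Letter.r i) 1) ∈
          wordSpan k fun w => exβ (i + 2) ≤ w.val ∧ w.measure ≤ 2 ^ (i + 2) := by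
        apply poly_mem_wordSpan
        simp only [map_add, Word.val_single, Word.measure_single, Letter.val, Letter.measure]
        push_cast
        refine ⟨by linarith, ?_⟩
        have := Nat.one_le_two_pow (n := i)
        rw [pow_add]
        omega
      exact add_mem hm hm
    · rintro w ⟨h1, h2⟩
      exact ⟨le_trans (le_add_of_nonneg_right (by positivity)) h1, h2⟩

/-- The word `w` is congruent to `u` modulo smaller words of larger value. -/
def Straightens (k : Type*) [Field k] (w u : Word) : Prop :=
  u.val = w.val ∧ u.measure < w.measure ∧
    w.poly k - u.poly k ∈ wordSpan k fun w' => w.val < w'.val ∧ w'.measure < w.measure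

theorem Straightens.add {w u : Word} (h : Straightens k w u) (v : Word) :
    Straightens k (v + w) (v + u) := by
  obtain ⟨h1, h2, h3⟩ := h
  refine ⟨by simp [h1], by simpa using h2, ?_⟩
  rw [Word.poly_add, Word.poly_add, ← mul_sub]
  refine mul_mem_wordSpan (p := fun w => w = v) ?_ (poly_mem_wordSpan rfl) h3
  rintro _ w' rfl ⟨h4, h5⟩
  simp only [map_add]
  exact ⟨by linarith, by omega⟩

open Finsupp (single)

/-- Here `y² - x³ = P_2 = x R_1 - Q_2`. -/
theorem straightens_y : Straightens k (single Letter.y 2) (single Letter.x 3) := by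
  refine ⟨by norm_num [Letter.val], by simp [Letter.measure], ?_⟩
  have h : Word.poly k (single Letter.y 2) - Word.poly k (single Letter.x 3) =
      Word.poly k (single Letter.x 1 + single (Letter.r 0) 1) -
        Word.poly k (single (Letter.q 0) 1) := by
    simp [Word.poly_add, Letter.poly, exQ, exP, exR]
  rw [h]
  refine sub_mem (poly_mem_wordSpan ?_) (poly_mem_wordSpan ?_) <;>
    norm_num [Letter.val, Letter.measure, exβ, exγ]

theorem straightens_q_zero : Straightens k (single (Letter.q 0) 3) (single Letter.x 13) := by
  refine ⟨by norm_num [Letter.val, exγ], by simp [Letter.measure], ?_⟩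
  have h : Word.poly k (single (Letter.q 0) 3) - Word.poly k (single Letter.x 13) =
      Word.poly k (single (Letter.q 1) 1) := by
    simp [Letter.poly, exQ]
  rw [h]
  refine poly_mem_wordSpan ?_
  norm_num [Letter.val, Letter.measure, exβ, exγ]

/-- The summand 1 in the letter weights counts here: the cube weighs `2·3^(j+2) + 3`, the new letter
only `2·3^(j+2) + 1`. -/
theorem straightens_q_succ (j : ℕ) : Straightens k (single (Letter.q (j + 1)) 3)
    (single Letter.x (35 * 3 ^ j) + single (Letter.q j) 1) := by
  refine ⟨?_, ?_, ?_⟩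
  · simp [-Finsupp.single_mul, Letter.val, three_mul_exγ]
  · simp [-Finsupp.single_mul, Letter.measure]
    rw [pow_succ]
    omega
  have h : Word.poly k (single (Letter.q (j + 1)) 3) -
      Word.poly k (single Letter.x (35 * 3 ^ j) + single (Letter.q j) 1) =
      Word.poly k (single (Letter.q (j + 2)) 1) := by
    simp [-Finsupp.single_mul, Word.poly_add, Letter.poly, exQ]
  rw [h]
  refine poly_mem_wordSpan ⟨?_, ?_⟩
  · simpa [Letter.val] using three_mul_exγ_lt (j + 1)
  · simp [-Finsupp.single_mul, Letter.measure]
    rw [pow_succ, pow_succ]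
    omega

theorem straightens_r_zero : Straightens k (single (Letter.r 0) 2)
    (single Letter.x 3 + single Letter.y 1) := by
  refine ⟨by norm_num [Letter.val, exβ], by simp [Letter.measure], ?_⟩
  have h : Word.poly k (single (Letter.r 0) 2) -
      Word.poly k (single Letter.x 3 + single Letter.y 1) =
      Word.poly k (single (Letter.r 1) 1) := by
    simp [Word.poly_add, Letter.poly, exR, exP]
  rw [h]
  refine poly_mem_wordSpan ?_
  norm_num [Letter.val, Letter.measure, exβ]

/-- Substitute `P_{i+2} = x^(2^i) R_{i+1} - correction` in the tail of the recursion for `R_{i+3}`;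
the exponent of `x` becomes `3·2^(i+1) + 2^i = 7·2^i`. -/
theorem straightens_r_succ (i : ℕ) : Straightens k (single (Letter.r (i + 1)) 2)
    (single Letter.x (7 * 2 ^ i) + single (Letter.r i) 1) := by
  have hβ := two_mul_exβ (i + 1)
  rw [pow_succ] at hβ
  have hi := Nat.one_le_two_pow (n := i)
  refine ⟨?_, ?_, ?_⟩
  · simp [-Finsupp.single_mul, Letter.val]
    rw [pow_succ]
    linarith
  · simp [-Finsupp.single_mul, Letter.measure]
    omega
  have h : Word.poly k (single (Letter.r (i + 1)) 2) -
      Word.poly k (single Letter.x (7 * 2 ^ i) + single (Letter.r i) 1) =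
      Word.poly k (single (Letter.r (i + 2)) 1) -
        Word.poly k (single Letter.x (3 * 2 ^ (i + 1))) * correction k i := by
    simp only [Word.poly_add, Letter.poly, exR, Word.poly_single, correction]
    ring
  rw [h]
  refine sub_mem (poly_mem_wordSpan ⟨?_, ?_⟩) (mul_mem_wordSpan (p := fun w => w = single Letter.x
    (3 * 2 ^ (i + 1))) ?_ (poly_mem_wordSpan rfl) (correction_mem i))
  · have := two_mul_exβ_lt (i + 2)
    simp only [Letter.val, Word.val_single, pow_succ] at *
    push_cast
    linarith
  · simp [-Finsupp.single_mul, Letter.measure]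
    rw [pow_succ, pow_succ]
    omega
  · rintro _ w' rfl ⟨h1, h2⟩
    have h0 : (0 : ℚ) < 1 / 2 ^ (i + 2) := by positivity
    simp only [map_add, Letter.val, Word.val_single, Word.measure_single, Letter.measure] at *
    push_cast
    rw [pow_succ] at *
    refine ⟨by linarith, ?_⟩
    rw [pow_succ] at h2
    omega

/-! ### Straightening of words -/

theorem Word.exists_straightens {w : Word} (hw : ¬ w.IsStandard) : ∃ u, Straightens k w u := by
  have key : ∀ (l : Letter) (n : ℕ) (u : Word), n ≤ w l → Straightens k (single l n) u →
      ∃ u, Straightens k w u := by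
    intro l n u hn hu
    have h := hu.add (w - single l n)
    rw [tsub_add_cancel_of_le (Finsupp.single_le_iff.2 hn)] at h
    exact ⟨_, h⟩
  rw [IsStandard] at hw
  push Not at hw
  obtain ⟨l, hl⟩ := hw
  cases l with
  | x => exact absurd hl (by simp [Letter.cap])
  | y => exact key _ 2 _ (by simp only [Letter.cap] at hl; exact_mod_cast hl) straightens_y
  | q j =>
    have hl' : 3 ≤ w (Letter.q j) := by simp only [Letter.cap] at hl; exact_mod_cast hl
    cases j with
    | zero => exact key _ 3 _ hl' straightens_q_zero
    | succ j => exact key _ 3 _ hl' (straightens_q_succ j)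
  | r i =>
    have hl' : 2 ≤ w (Letter.r i) := by simp only [Letter.cap] at hl; exact_mod_cast hl
    cases i with
    | zero => exact key _ 2 _ hl' straightens_r_zero
    | succ i => exact key _ 2 _ hl' (straightens_r_succ i)

/-- Strong induction on the weight: the replacing word and all error words are lighter, so each is
covered by the induction hypothesis. The error words have larger value, and straightening never
lowers it. -/
theorem Word.exists_isStandard (w : Word) : ∃ s : Word, s.IsStandard ∧ s.val = w.val ∧
    w.poly k - s.poly k ∈ wordSpan k fun s' => s'.IsStandard ∧ w.val < s'.val := by
  induction h : w.measure using Nat.strong_induction_on generalizing w with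
  | _ n ih =>
    subst h
    by_cases hw : w.IsStandard
    · exact ⟨w, hw, rfl, by simp⟩
    obtain ⟨u, hu1, hu2, hu3⟩ := Word.exists_straightens (k := k) hw
    obtain ⟨s, hs, hsu, hsp⟩ := ih _ hu2 u rfl
    refine ⟨s, hs, hsu.trans hu1, ?_⟩
    rw [← sub_add_sub_cancel (w.poly k) (u.poly k) (s.poly k)]
    rw [hu1] at hsp
    refine add_mem (wordSpan_le ?_ hu3) hsp
    rintro w' ⟨h1, h2⟩
    obtain ⟨s', hs', hsu', hsp'⟩ := ih _ h2 w' rfl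
    rw [← sub_add_cancel (w'.poly k) (s'.poly k)]
    refine add_mem (wordSpan_mono ?_ hsp') (poly_mem_wordSpan ⟨hs', by rwa [hsu']⟩)
    rintro t ⟨ht, ht'⟩
    exact ⟨ht, h1.trans ht'⟩

end wordSpan

/-! ### Standard words are determined by their values -/

section separation

theorem weight_eq_imp_sum_eq_zero {u : Letter → ℚ} {s t : Word} {S : Finset Letter}
    (hS : ∀ l, s l ≠ t l → l ∈ S) (h : Finsupp.weight u s = Finsupp.weight u t) :
    ∑ l ∈ S, ((s l : ℤ) - (t l : ℤ) : ℤ) * u l = 0 := by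
  classical
  set U := s.support ∪ t.support ∪ S with hU
  have hs : Finsupp.weight u s = ∑ l ∈ U, (s l : ℚ) * u l := by
    rw [Finsupp.weight_apply, Finsupp.sum_of_support_subset s (s := U) _ _ (by simp)]
    · simp [nsmul_eq_mul]
    · intro l hl
      simp [hU, Finsupp.mem_support_iff.1 hl]
  have ht : Finsupp.weight u t = ∑ l ∈ U, (t l : ℚ) * u l := by
    rw [Finsupp.weight_apply, Finsupp.sum_of_support_subset t (s := U) _ _ (by simp)]
    · simp [nsmul_eq_mul]
    · intro l hl
      simp [hU, Finsupp.mem_support_iff.1 hl]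
  rw [hs, ht, ← sub_eq_zero, ← Finset.sum_sub_distrib] at h
  rw [← h]
  rw [← Finset.sum_subset (Finset.subset_union_right : S ⊆ U)]
  · exact Finset.sum_congr rfl fun l _ => by push_cast; ring
  · intro l _ hl
    rw [not_imp_comm.1 (hS l) hl, sub_self]

/-- Two words of the same weight agree on a set of letters that carries the terms of largest
`p`-adic norm and on which these norms are distinct. -/
theorem eqOn_of_weight_eq (p : ℕ) [Fact p.Prime] {u : Letter → ℚ} {s t : Word}
    (h : Finsupp.weight u s = Finsupp.weight u t) {ι : Type*} (a : ι → Letter) (rk : ι → ℤ)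
    (hrk : Function.Injective rk) (hu : ∀ i, padicNorm p (u (a i)) = (p : ℚ) ^ rk i)
    (hd : ∀ i, s (a i) ≠ t (a i) → ¬ (p : ℤ) ∣ (s (a i) : ℤ) - (t (a i) : ℤ))
    (ho : ∀ l, s l ≠ t l → (∀ i, l ≠ a i) → ∀ i, padicNorm p (u l) < (p : ℚ) ^ rk i) (i : ι) :
    s (a i) = t (a i) := by
  classical
  by_contra hne
  set S := (s.support ∪ t.support).filter fun l => s l ≠ t l with hS
  have hmem : ∀ l, l ∈ S ↔ s l ≠ t l := by
    intro l
    simp only [hS, Finset.mem_filter, Finset.mem_union, Finsupp.mem_support_iff,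
      and_iff_right_iff_imp]
    intro h1
    by_contra! h2
    exact h1 (h2.1.trans h2.2.symm)
  have hp : (1 : ℚ) < p := by exact_mod_cast (Fact.out : p.Prime).one_lt
  obtain ⟨l, hl, hmax⟩ := Finset.exists_max_image S (fun l => padicNorm p (u l))
    ⟨a i, (hmem _).2 hne⟩
  obtain ⟨j, rfl⟩ : ∃ j, l = a j := by
    by_contra! hc
    have h1 := ho l ((hmem l).1 hl) hc i
    rw [← hu] at h1
    exact absurd (hmax _ ((hmem _).2 hne)) (not_le.2 h1)
  have hterm : padicNorm p ((((s (a j) : ℤ) - (t (a j) : ℤ) : ℤ) : ℚ) * u (a j)) =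
      (p : ℚ) ^ rk j := by
    rw [padicNorm.mul, (padicNorm.int_eq_one_iff _).2 (hd j ((hmem _).1 hl)), one_mul, hu]
  refine sum_ne_zero_of_padicNorm_lt (p := p) hl ?_ ?_
    (weight_eq_imp_sum_eq_zero (fun l => (hmem l).2) h)
  · intro h0
    rw [h0, padicNorm.zero] at hterm
    exact absurd hterm (zpow_pos (zero_lt_one.trans hp) _).ne
  · intro l' hl' hne'
    rw [hterm, padicNorm.mul]
    refine (mul_le_of_le_one_left (padicNorm.nonneg _) (padicNorm.of_int _)).trans_lt ?_
    by_cases hc : ∀ i, l' ≠ a i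
    · exact ho l' ((hmem _).1 hl') hc j
    · push Not at hc
      obtain ⟨m, rfl⟩ := hc
      refine lt_of_le_of_ne ((hmax _ hl').trans_eq (hu j)) fun heq => ?_
      rw [hu] at heq
      exact hne' (congrArg a (hrk (zpow_right_injective₀ (zero_lt_one.trans hp) hp.ne' heq)))

theorem eq_of_weight_eq_of_eqOn {u : Letter → ℚ} {s t : Word} {l : Letter} (hl : u l ≠ 0)
    (h : Finsupp.weight u s = Finsupp.weight u t) (hst : ∀ l', l' ≠ l → s l' = t l') :
    s = t := by
  classical
  ext l'
  by_cases hc : l' = l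
  · subst hc
    have h0 := weight_eq_imp_sum_eq_zero (S := {l'})
      (fun l hl => by simpa using not_imp_comm.1 (hst l) hl) h
    rw [Finset.sum_singleton, mul_eq_zero, or_iff_left hl] at h0
    have h1 : (s l' : ℤ) - (t l' : ℤ) = 0 := by exact_mod_cast h0
    omega
  · exact hst l' hc

/-- The exponents are recovered in the order `Q`, `R`, `y`, `x`. Caps 2 and 1 make differences of
exponents prime to 3 and 2; the norms are `3^(j+1)` for `Q_{j+2}`, then `2^(i+2)` for `R_{i+1}` and
2 for `y`. -/
theorem Word.IsStandard.val_injective {s t : Word} (hs : s.IsStandard) (ht : t.IsStandard)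
    (h : s.val = t.val) : s = t := by
  have hq : ∀ j, s (Letter.q j) = t (Letter.q j) := by
    refine eqOn_of_weight_eq 3 h Letter.q (fun j => (j : ℤ) + 1) (fun _ _ h => by simpa using h)
      ?_ ?_ ?_
    · intro j
      exact_mod_cast padicNorm_three_exγ j
    · intro j hne
      have h1 : s (Letter.q j) ≤ 2 := hs.le rfl
      have h2 : t (Letter.q j) ≤ 2 := ht.le rfl
      omega
    · intro l _ hl j
      have h1 : (1 : ℚ) < ((3 : ℕ) : ℚ) ^ ((j : ℤ) + 1) :=
        one_lt_zpow₀ (by norm_num) (by omega)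
      refine lt_of_le_of_lt ?_ h1
      cases l with
      | x => simp [Letter.val]
      | y => simpa [Letter.val, exβ] using padicNorm_three_exβ_le 1
      | q j => exact absurd rfl (hl j)
      | r i =>
        have h2 : padicNorm 3 ((2 : ℚ) ^ i) ≤ 1 := by
          have := padicNorm.of_int (p := 3) (2 ^ i)
          exact_mod_cast this
        exact padicNorm.sub.trans (max_le (padicNorm_three_exβ_le (i + 2)) h2)
  have hr : ∀ i, s (Letter.r i) = t (Letter.r i) := by
    refine eqOn_of_weight_eq 2 h Letter.r (fun i => (i : ℤ) + 2) (fun _ _ h => by simpa using h)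
      ?_ ?_ ?_
    · intro i
      obtain ⟨n, hn, hni⟩ := exβ_eq_odd_div (i + 2)
      -- Subtracting the integer `2^i` changes the numerator by an even number, so it stays odd.
      have h1 := padicNorm_div_pow (p := 2) (n := n - 2 ^ i * 2 ^ (i + 2))
        (by rw [pow_succ, ← mul_assoc]; push_cast; omega) (i + 2)
      have h2 : Letter.val (Letter.r i) =
          ((n - 2 ^ i * 2 ^ (i + 2) : ℤ) : ℚ) / ((2 : ℕ) : ℚ) ^ (i + 2) := by
        rw [Letter.val, hni]
        push_cast
        field_simp
      rw [h2, h1]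
      norm_cast
    · intro i hne
      have h1 : s (Letter.r i) ≤ 1 := hs.le rfl
      have h2 : t (Letter.r i) ≤ 1 := ht.le rfl
      omega
    · intro l hne hl i
      have h1 : (2 : ℚ) < ((2 : ℕ) : ℚ) ^ ((i : ℤ) + 2) := by
        have : ((2 : ℕ) : ℚ) ^ (1 : ℤ) < ((2 : ℕ) : ℚ) ^ ((i : ℤ) + 2) :=
          zpow_lt_zpow_right₀ (by norm_num) (by omega)
        simpa using this
      refine lt_of_le_of_lt ?_ h1
      cases l with
      | x => simp [Letter.val]
      | y => exact (padicNorm_two_exβ 1).le.trans (by norm_num)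
      | q j => exact absurd (hq j) hne
      | r i => exact absurd rfl (hl i)
  have hy : s Letter.y = t Letter.y := by
    refine eqOn_of_weight_eq 2 h (fun _ : Unit => Letter.y) (fun _ => 1) (fun _ _ _ => rfl)
      ?_ ?_ ?_ ()
    · intro _
      exact_mod_cast padicNorm_two_exβ 1
    · intro _ hne
      have h1 : s Letter.y ≤ 1 := hs.le rfl
      have h2 : t Letter.y ≤ 1 := ht.le rfl
      omega
    · intro l hne hl _
      cases l with
      | x => simp [Letter.val]
      | y => exact absurd rfl (hl ())
      | q j => exact absurd (hq j) hne
      | r i => exact absurd (hr i) hne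
  refine eq_of_weight_eq_of_eqOn (l := Letter.x) (by simp [Letter.val]) h fun l hl => ?_
  cases l with
  | x => exact absurd rfl hl
  | y => exact hy
  | q j => exact hq j
  | r i => exact hr i

/-! ### Linear independence of the standard words -/

namespace Letter

/-- The degree of a generator in `y` and `z`. -/
def degree : Letter → ℕ
  | x => 0
  | y => 1
  | q j => 2 * 3 ^ j
  | r i => 2 ^ i

/-- The exponents of the monomial of largest degree in `y` and `z` of a generator. -/
def exponents : Letter → Fin 3 →₀ ℕ
  | x => Finsupp.single 0 1
  | y => Finsupp.single 1 1
  | q j => Finsupp.single 1 (2 * 3 ^ j)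
  | r i => Finsupp.single 2 (2 ^ i)

end Letter

namespace Word

/-- The degree of a word in `y` and `z`. -/
def degree : Word →+ ℕ := Finsupp.weight Letter.degree

/-- The exponents of the monomial of largest degree in `y` and `z` of a word. -/
def exponents : Word →+ Fin 3 →₀ ℕ := Finsupp.weight Letter.exponents

theorem exponents_apply (w : Word) (m : Fin 3) :
    (exponents w m : ℚ) = Finsupp.weight (fun l => (l.exponents m : ℚ)) w := by
  simp [exponents, Finsupp.weight_apply, Finsupp.sum, Finsupp.finsetSum_apply]

/-- The exponent of `z` is a binary expansion with the `R` exponents as digits. That of `y` has the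
exponent of the letter `y` as parity, and the rest is twice a ternary expansion in the `Q`
exponents. Low digits now dominate, hence the negative ranks. -/
theorem IsStandard.exponents_injective {s t : Word} (hs : s.IsStandard) (ht : t.IsStandard)
    (h : exponents s = exponents t) : s = t := by
  have hm : ∀ m : Fin 3, Finsupp.weight (fun l : Letter => (l.exponents m : ℚ)) s =
      Finsupp.weight (fun l : Letter => (l.exponents m : ℚ)) t := by
    intro m
    rw [← exponents_apply, ← exponents_apply, h]
  have hr : ∀ i, s (Letter.r i) = t (Letter.r i) := by
    refine eqOn_of_weight_eq 2 (hm 2) Letter.r (fun i => -(i : ℤ)) (fun _ _ h => by simpa using h)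
      ?_ ?_ ?_
    · intro i
      have h1 := padicNorm_self_pow 2 i
      simpa [Letter.exponents] using h1
    · intro i hne
      have h1 : s (Letter.r i) ≤ 1 := hs.le rfl
      have h2 : t (Letter.r i) ≤ 1 := ht.le rfl
      omega
    · intro l hne hl i
      cases l with
      | r i => exact absurd rfl (hl i)
      | _ => simp [Letter.exponents]
  have hy : s Letter.y = t Letter.y := by
    refine eqOn_of_weight_eq 2 (hm 1) (fun _ : Unit => Letter.y) (fun _ => 0) (fun _ _ _ => rfl)
      ?_ ?_ ?_ ()
    · intro _
      simp [Letter.exponents]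
    · intro _ hne
      have h1 : s Letter.y ≤ 1 := hs.le rfl
      have h2 : t Letter.y ≤ 1 := ht.le rfl
      omega
    · intro l hne hl _
      cases l with
      | x => simp [Letter.exponents]
      | y => exact absurd rfl (hl ())
      | q j =>
        have h1 := (padicNorm.nat_lt_one_iff (p := 2) (2 * 3 ^ j)).2 (dvd_mul_right _ _)
        simpa [Letter.exponents] using h1
      | r i => simp [Letter.exponents]
  have hq : ∀ j, s (Letter.q j) = t (Letter.q j) := by
    refine eqOn_of_weight_eq 3 (hm 1) Letter.q (fun j => -(j : ℤ)) (fun _ _ h => by simpa using h)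
      ?_ ?_ ?_
    · intro j
      have h1 := padicNorm_self_pow 3 j
      have h2 : padicNorm 3 ((2 : ℕ) : ℚ) = 1 := (padicNorm.nat_eq_one_iff 2).2 (by norm_num)
      rw [zpow_neg, zpow_natCast, ← h1]
      simp only [Letter.exponents, Finsupp.single_eq_same, Nat.cast_mul, padicNorm.mul, h2, one_mul]
      push_cast
      rfl
    · intro j hne
      have h1 : s (Letter.q j) ≤ 2 := hs.le rfl
      have h2 : t (Letter.q j) ≤ 2 := ht.le rfl
      omega
    · intro l hne hl j
      cases l with
      | x => simp [Letter.exponents]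
      | y => exact absurd hy hne
      | q j => exact absurd rfl (hl j)
      | r i => simp [Letter.exponents]
  refine eq_of_weight_eq_of_eqOn (l := Letter.x) (by simp [Letter.exponents]) (hm 0) fun l hl => ?_
  cases l with
  | x => exact absurd rfl hl
  | y => exact hy
  | q j => exact hq j
  | r i => exact hr i

end Word

end separation

/-! ### Leading monomials for the degree in `y` and `z` -/

section independence

variable {k : Type*} [Field k]

/-- The homomorphism to `k[x, y, z][T]` that multiplies `y` and `z` by `T`. -/
def scale (k : Type*) [Field k] : Poly k →ₐ[k] Polynomial (Poly k) :=
  aeval ![Polynomial.C (X 0), Polynomial.C (X 1) * Polynomial.X, Polynomial.C (X 2) * Polynomial.X]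

/-- `g` has degree `d` in `T` and its leading coefficient is a multiple of one monomial. -/
def HasLeadingMonomial (g : Polynomial (Poly k)) (d : ℕ) (e : Fin 3 →₀ ℕ) : Prop :=
  g.natDegree = d ∧ ∃ c : k, c ≠ 0 ∧ g.leadingCoeff = monomial e c

namespace HasLeadingMonomial

variable {g h : Polynomial (Poly k)} {d d' : ℕ} {e e' : Fin 3 →₀ ℕ}

theorem one : HasLeadingMonomial (1 : Polynomial (Poly k)) 0 0 :=
  ⟨Polynomial.natDegree_one, 1, one_ne_zero, by simp⟩

theorem ne_zero (hg : HasLeadingMonomial g d e) : g ≠ 0 := by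
  rintro rfl
  obtain ⟨-, c, hc, h⟩ := hg
  rw [Polynomial.leadingCoeff_zero, eq_comm, monomial_eq_zero] at h
  exact hc h

theorem mul (hg : HasLeadingMonomial g d e) (hh : HasLeadingMonomial h d' e') :
    HasLeadingMonomial (g * h) (d + d') (e + e') := by
  have h1 := Polynomial.natDegree_mul hg.ne_zero hh.ne_zero
  obtain ⟨rfl, c, hc, hgc⟩ := hg
  obtain ⟨rfl, c', hc', hhc⟩ := hh
  exact ⟨h1, c * c', mul_ne_zero hc hc', by
    rw [Polynomial.leadingCoeff_mul, hgc, hhc, monomial_mul]⟩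

theorem pow (hg : HasLeadingMonomial g d e) (n : ℕ) :
    HasLeadingMonomial (g ^ n) (n * d) (n • e) := by
  induction n with
  | zero => simpa using one
  | succ n ih =>
    rw [pow_succ, add_mul, one_mul, add_smul, one_smul]
    exact ih.mul hg

theorem sub (hg : HasLeadingMonomial g d e) (hh : h.natDegree < d) :
    HasLeadingMonomial (g - h) d e := by
  obtain ⟨rfl, c, hc, hgc⟩ := hg
  exact ⟨Polynomial.natDegree_sub_eq_left_of_natDegree_lt hh, c, hc, by
    rw [Polynomial.leadingCoeff_sub_of_degree_lt (Polynomial.degree_lt_degree hh), hgc]⟩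

theorem neg (hg : HasLeadingMonomial g d e) : HasLeadingMonomial (-g) d e := by
  obtain ⟨rfl, c, hc, hgc⟩ := hg
  exact ⟨Polynomial.natDegree_neg g, -c, neg_ne_zero.2 hc, by
    rw [Polynomial.leadingCoeff_neg, hgc, map_neg]⟩

theorem coeff_self (hg : HasLeadingMonomial g d e) : coeff e (g.coeff d) ≠ 0 := by
  obtain ⟨rfl, c, hc, hgc⟩ := hg
  rwa [Polynomial.coeff_natDegree, hgc, coeff_monomial, if_pos rfl]

theorem coeff_eq_zero (hg : HasLeadingMonomial g d e) (hd : d ≤ d') (he : d = d' → e ≠ e') :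
    coeff e' (g.coeff d') = 0 := by
  classical
  obtain ⟨rfl, c, hc, hgc⟩ := hg
  obtain h | h := hd.lt_or_eq
  · rw [Polynomial.coeff_eq_zero_of_natDegree_lt h, coeff_zero]
  · rw [← h, Polynomial.coeff_natDegree, hgc, coeff_monomial, if_neg (he h)]

end HasLeadingMonomial

theorem hasLeadingMonomial_scale_X_zero :
    HasLeadingMonomial (scale k (X 0)) 0 (Finsupp.single 0 1) := by
  refine ⟨by simp [scale], 1, one_ne_zero, by simp [scale]; rfl⟩

theorem hasLeadingMonomial_scale_X_one :
    HasLeadingMonomial (scale k (X 1)) 1 (Finsupp.single 1 1) := by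
  refine ⟨by simp [scale], 1, one_ne_zero, by simp [scale]; rfl⟩

theorem hasLeadingMonomial_scale_X_two :
    HasLeadingMonomial (scale k (X 2)) 1 (Finsupp.single 2 1) := by
  refine ⟨by simp [scale], 1, one_ne_zero, by simp [scale]; rfl⟩

theorem natDegree_scale_X_zero_pow_mul (n : ℕ) (f : Poly k) :
    (scale k (X 0 ^ n * f)).natDegree ≤ (scale k f).natDegree := by
  rw [map_mul, map_pow]
  refine Polynomial.natDegree_mul_le.trans ?_
  rw [(hasLeadingMonomial_scale_X_zero.pow n).1]
  omega

theorem natDegree_scale_exP (i : ℕ) : (scale k (exP k (i + 1))).natDegree ≤ 2 ^ i := by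
  induction i using Nat.twoStepInduction with
  | zero => exact hasLeadingMonomial_scale_X_one.1.le
  | one =>
    have h : exP k 2 = X 1 ^ 2 - X 0 ^ 3 * 1 := by rw [exP, mul_one]
    rw [h, map_sub, map_pow]
    refine (Polynomial.natDegree_sub_le _ _).trans (max_le ?_ ?_)
    · rw [(hasLeadingMonomial_scale_X_one.pow 2).1]
      norm_num
    · refine (natDegree_scale_X_zero_pow_mul _ _).trans ?_
      simp
  | more i h1 h2 =>
    rw [exP, map_sub, map_pow]
    refine (Polynomial.natDegree_sub_le _ _).trans (max_le ?_ ?_)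
    · refine Polynomial.natDegree_pow_le.trans ?_
      rw [pow_succ' 2 (i + 1)]
      exact Nat.mul_le_mul_left 2 h2
    · refine (natDegree_scale_X_zero_pow_mul _ _).trans (h1.trans ?_)
      exact Nat.pow_le_pow_right (by norm_num) (by omega)

theorem hasLeadingMonomial_scale_exR (i : ℕ) :
    HasLeadingMonomial (scale k (exR k (i + 1))) (2 ^ i) (Finsupp.single 2 (2 ^ i)) := by
  induction i with
  | zero => exact hasLeadingMonomial_scale_X_two
  | succ i ih =>
    rw [exR, map_sub, map_pow]
    have h := ih.pow 2
    rw [Finsupp.smul_single, smul_eq_mul, ← pow_succ'] at h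
    refine h.sub ((natDegree_scale_X_zero_pow_mul _ _).trans_lt
      ((natDegree_scale_exP i).trans_lt ?_))
    exact Nat.pow_lt_pow_right (by norm_num) (by omega)

/-- Since `x` has degree 0, `x z` has degree 1 and `-y²` dominates; this is why `Q` letters lead
with powers of `y`. -/
theorem hasLeadingMonomial_scale_exQ_two :
    HasLeadingMonomial (scale k (exQ k 2)) 2 (Finsupp.single 1 2) := by
  have h : exQ k 2 = -(X 1 ^ 2 - (X 0 ^ 1 * X 2 + X 0 ^ 3 * 1)) := by rw [exQ, exP]; ring
  have h1 := (hasLeadingMonomial_scale_X_one (k := k)).pow 2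
  rw [Finsupp.smul_single, smul_eq_mul, mul_one] at h1
  rw [h, map_neg, map_sub, map_pow]
  refine (h1.sub ?_).neg
  rw [map_add]
  refine (Polynomial.natDegree_add_le _ _).trans_lt (max_lt ?_ ?_)
  · refine (natDegree_scale_X_zero_pow_mul _ _).trans_lt ?_
    rw [hasLeadingMonomial_scale_X_two.1]
    norm_num
  · refine (natDegree_scale_X_zero_pow_mul _ _).trans_lt ?_
    simp

theorem hasLeadingMonomial_scale_exQ (j : ℕ) :
    HasLeadingMonomial (scale k (exQ k (j + 2))) (2 * 3 ^ j)
      (Finsupp.single 1 (2 * 3 ^ j)) := by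
  have hsucc : ∀ {j : ℕ} {f : Poly k}, HasLeadingMonomial (scale k (exQ k (j + 2))) (2 * 3 ^ j)
      (Finsupp.single 1 (2 * 3 ^ j)) → (scale k f).natDegree < 2 * 3 ^ (j + 1) →
      HasLeadingMonomial (scale k (exQ k (j + 2) ^ 3 - f)) (2 * 3 ^ (j + 1))
        (Finsupp.single 1 (2 * 3 ^ (j + 1))) := by
    intro j f hj hf
    have h := hj.pow 3
    rw [Finsupp.smul_single, smul_eq_mul,
      show 3 * (2 * 3 ^ j) = 2 * 3 ^ (j + 1) by ring] at h
    rw [map_sub, map_pow]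
    exact h.sub hf
  induction j using Nat.twoStepInduction with
  | zero => exact hasLeadingMonomial_scale_exQ_two
  | one =>
    rw [exQ, ← mul_one (X 0 ^ 13)]
    refine hsucc hasLeadingMonomial_scale_exQ_two
      ((natDegree_scale_X_zero_pow_mul _ _).trans_lt ?_)
    simp
  | more j h1 h2 =>
    rw [exQ]
    refine hsucc h2 ((natDegree_scale_X_zero_pow_mul _ _).trans_lt ?_)
    rw [h1.1, pow_succ, pow_succ]
    have : 0 < 3 ^ j := by positivity
    omega

theorem Letter.hasLeadingMonomial (l : Letter) :
    HasLeadingMonomial (scale k (l.poly k)) l.degree l.exponents := by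
  cases l with
  | x => exact hasLeadingMonomial_scale_X_zero
  | y => exact hasLeadingMonomial_scale_X_one
  | q j => exact hasLeadingMonomial_scale_exQ j
  | r i => exact hasLeadingMonomial_scale_exR i

theorem Word.hasLeadingMonomial (w : Word) :
    HasLeadingMonomial (scale k (w.poly k)) (Word.degree w) (Word.exponents w) := by
  induction w using Finsupp.induction_linear with
  | zero => simpa using HasLeadingMonomial.one
  | add w w' h h' =>
    rw [Word.poly_add, map_mul, map_add, map_add]
    exact h.mul h'
  | single l n =>
    rw [Word.poly_single, map_pow, Word.degree, Word.exponents, Finsupp.weight_single,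
      Finsupp.weight_single]
    exact l.hasLeadingMonomial.pow n

/-- In a relation, take a term of largest degree with nonzero coefficient: no other term contributes
to its top monomial. -/
theorem linearIndependent_standard :
    LinearIndependent k fun s : {s : Word // s.IsStandard} => s.1.poly k := by
  rw [linearIndependent_iff']
  classical
  intro S c hc
  by_contra! hne
  obtain ⟨i, hi, hci⟩ := hne
  obtain ⟨s, hs, hmax⟩ := Finset.exists_max_image (S.filter fun s => c s ≠ 0)
    (fun s => Word.degree s.1) ⟨i, Finset.mem_filter.2 ⟨hi, hci⟩⟩
  rw [Finset.mem_filter] at hs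
  have h := congrArg (fun f => coeff (Word.exponents s.1) ((scale k f).coeff (Word.degree s.1))) hc
  simp only [map_sum, map_smul, Polynomial.finsetSum_coeff, Polynomial.coeff_smul, coeff_sum,
    map_zero, Polynomial.coeff_zero, coeff_zero, coeff_smul] at h
  rw [Finset.sum_eq_single s] at h
  · exact (mul_ne_zero hs.2 s.1.hasLeadingMonomial.coeff_self) h
  · intro t ht hts
    by_cases hct : c t = 0
    · rw [hct, zero_smul]
    rw [t.1.hasLeadingMonomial.coeff_eq_zero (hmax t (Finset.mem_filter.2 ⟨ht, hct⟩)), smul_zero]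
    intro _ he
    exact hts (Subtype.ext (t.2.exponents_injective s.2 he))
  · exact fun h => absurd hs.1 h

/-! ### Leading words -/

theorem wordSpan_lt_le_standard (v : ℚ) :
    (wordSpan k fun w => v < w.val) ≤ wordSpan k fun s => s.IsStandard ∧ v < s.val := by
  refine wordSpan_le fun w hw => ?_
  obtain ⟨s, hs, hsw, hsp⟩ := w.exists_isStandard (k := k)
  rw [← sub_add_cancel (w.poly k) (s.poly k)]
  refine add_mem (wordSpan_mono ?_ hsp) (poly_mem_wordSpan ⟨hs, hsw ▸ hw⟩)
  rintro t ⟨ht, ht'⟩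
  exact ⟨ht, hw.trans ht'⟩

/-- Straightening reduces this to a standard word, which would then be a combination of other
standard words. It makes the filtration by value strict at every word, standard or not. -/
theorem Word.poly_notMem_wordSpan (w : Word) {v : ℚ} (hv : w.val ≤ v) :
    w.poly k ∉ wordSpan k fun w' => v < w'.val := by
  intro hw
  obtain ⟨s, hs, hsw, hsp⟩ := w.exists_isStandard (k := k)
  have hmem : s.poly k ∈ wordSpan k fun s' => s'.IsStandard ∧ w.val < s'.val := by
    rw [← sub_sub_cancel (w.poly k) (s.poly k)]
    refine sub_mem (wordSpan_lt_le_standard _ (wordSpan_mono (fun w' h => ?_) hw)) hsp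
    exact hv.trans_lt h
  refine (linearIndependent_standard (k := k)).notMem_span_image (s := {t | w.val < t.1.val}) (x := ⟨s, hs⟩)
    (by simp [hsw]) ?_
  refine Submodule.span_mono ?_ hmem
  rintro _ ⟨t, ⟨ht, ht'⟩, rfl⟩
  exact ⟨⟨t, ht⟩, ht', rfl⟩

theorem mem_wordSpan_true (f : Poly k) : f ∈ wordSpan k fun _ => True := by
  have hX : ∀ i, (X i : Poly k) ∈ wordSpan k fun _ => True := by
    intro i
    fin_cases i
    · simpa [Letter.poly] using
        poly_mem_wordSpan (k := k) (p := fun _ => True) (w := Finsupp.single Letter.x 1) trivial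
    · simpa [Letter.poly] using
        poly_mem_wordSpan (k := k) (p := fun _ => True) (w := Finsupp.single Letter.y 1) trivial
    · simpa [Letter.poly, exR, exQ] using
        poly_mem_wordSpan (k := k) (p := fun _ => True) (w := Finsupp.single (Letter.r 0) 1) trivial
  induction f using MvPolynomial.induction_on with
  | C a =>
    have := (wordSpan k fun _ => True).smul_mem a (poly_mem_wordSpan (w := 0) trivial)
    rwa [Word.poly_zero, smul_eq_C_mul, mul_one] at this
  | add f g hf hg => exact add_mem hf hg
  | mul_X f i hf => exact mul_mem_wordSpan (fun _ _ _ _ => trivial) hf (hX i)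

/-- `f` is a nonzero multiple of a word of value `v` plus words of larger value. -/
def HasLeadingWord (f : Poly k) (v : ℚ) : Prop :=
  ∃ c : k, c ≠ 0 ∧ ∃ w : Word, w.val = v ∧ f - c • w.poly k ∈ wordSpan k fun w' => v < w'.val

theorem Word.hasLeadingWord (w : Word) : HasLeadingWord (w.poly k) w.val :=
  ⟨1, one_ne_zero, w, rfl, by simp⟩

theorem exists_hasLeadingWord {f : Poly k} (hf : f ≠ 0) : ∃ v, HasLeadingWord f v := by
  classical
  have hstd : f ∈ wordSpan k Word.IsStandard := by
    refine wordSpan_le (fun w _ => ?_) (mem_wordSpan_true f)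
    obtain ⟨s, hs, -, hsp⟩ := w.exists_isStandard (k := k)
    rw [← sub_add_cancel (w.poly k) (s.poly k)]
    exact add_mem (wordSpan_mono (fun _ h => h.1) hsp) (poly_mem_wordSpan hs)
  obtain ⟨c, hc, rfl⟩ := (Finsupp.mem_span_image_iff_linearCombination k).1 hstd
  rw [Finsupp.mem_supported] at hc
  have hne : c.support.Nonempty := by
    rw [Finsupp.support_nonempty_iff]
    rintro rfl
    exact hf (map_zero _)
  obtain ⟨s, hs, hmin⟩ := Finset.exists_min_image c.support Word.val hne
  refine ⟨s.val, c s, Finsupp.mem_support_iff.1 hs, s, rfl, ?_⟩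
  rw [Finsupp.linearCombination_apply, Finsupp.sum, ← Finset.add_sum_erase _ _ hs,
    add_sub_cancel_left]
  refine sum_mem fun t ht => Submodule.smul_mem _ _ (poly_mem_wordSpan ?_)
  rw [Finset.mem_erase] at ht
  -- Distinct standard words have distinct values, so the minimum is attained once and nothing can
  -- cancel.
  refine lt_of_le_of_ne (hmin t ht.2) fun h => ht.1 ?_
  exact ((hc hs : s.IsStandard).val_injective (hc ht.2) h).symm

theorem HasLeadingWord.mem {f : Poly k} {v : ℚ} (hf : HasLeadingWord f v) {v' : ℚ} (h : v' ≤ v) :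
    f ∈ wordSpan k fun w => v' ≤ w.val := by
  obtain ⟨c, hc, w, rfl, hw⟩ := hf
  rw [← sub_add_cancel f (c • w.poly k)]
  refine add_mem (wordSpan_mono (fun _ h' => ?_) hw) (Submodule.smul_mem _ _ (poly_mem_wordSpan h))
  exact h.trans h'.le

theorem HasLeadingWord.notMem {f : Poly k} {v : ℚ} (hf : HasLeadingWord f v) :
    f ∉ wordSpan k fun w => v < w.val := by
  obtain ⟨c, hc, w, rfl, hw⟩ := hf
  intro h
  have h1 := sub_mem h hw
  rw [sub_sub_cancel, Submodule.smul_mem_iff _ hc] at h1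
  exact w.poly_notMem_wordSpan le_rfl h1

theorem HasLeadingWord.mem_iff {f : Poly k} {v : ℚ} (hf : HasLeadingWord f v) {v' : ℚ} :
    (f ∈ wordSpan k fun w => v' ≤ w.val) ↔ v' ≤ v := by
  refine ⟨fun h => ?_, hf.mem⟩
  by_contra! hlt
  exact hf.notMem (wordSpan_mono (fun _ h' => hlt.trans_le h') h)

theorem HasLeadingWord.ne_zero {f : Poly k} {v : ℚ} (hf : HasLeadingWord f v) : f ≠ 0 := by
  rintro rfl
  exact hf.notMem (zero_mem _)

theorem HasLeadingWord.unique {f : Poly k} {v v' : ℚ} (hf : HasLeadingWord f v)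
    (hf' : HasLeadingWord f v') : v = v' :=
  le_antisymm (hf'.mem_iff.1 (hf.mem le_rfl)) (hf.mem_iff.1 (hf'.mem le_rfl))

/-- Leading words need not be standard, so the product of two of them is admissible as it stands. -/
theorem HasLeadingWord.mul {f g : Poly k} {v v' : ℚ} (hf : HasLeadingWord f v)
    (hg : HasLeadingWord g v') : HasLeadingWord (f * g) (v + v') := by
  have hfv := hf.mem le_rfl
  obtain ⟨c, hc, w, rfl, hw⟩ := hf
  obtain ⟨c', hc', w', rfl, hw'⟩ := hg
  refine ⟨c * c', mul_ne_zero hc hc', w + w', map_add _ _ _, ?_⟩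
  have h : f * g - (c * c') • (w + w').poly k =
      f * (g - c' • w'.poly k) + (f - c • w.poly k) * (c' • w'.poly k) := by
    rw [Word.poly_add]
    simp only [smul_eq_C_mul, map_mul]
    ring
  rw [h]
  refine add_mem (mul_mem_wordSpan ?_ hfv hw') (mul_mem_wordSpan (p' := fun u => w'.val ≤ u.val)
    ?_ hw (Submodule.smul_mem _ _ (poly_mem_wordSpan le_rfl)))
  · intro u u' hu hu'
    rw [map_add]
    exact add_lt_add_of_le_of_lt hu hu'
  · intro u u' hu hu'
    rw [map_add]
    exact add_lt_add_of_lt_of_le hu hu'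

theorem sub_C_constantCoeff_mem (f : Poly k) :
    f - C (constantCoeff f) ∈ wordSpan k fun w => 0 < w.val := by
  have hX : ∀ i, (X i : Poly k) ∈ wordSpan k fun w => 0 < w.val := by
    have h : ∀ l : Letter, l.poly k ∈ wordSpan k fun w => 0 < w.val := by
      intro l
      have := poly_mem_wordSpan (k := k) (p := fun w => 0 < w.val) (w := Finsupp.single l 1)
        (by simpa using l.val_pos)
      simpa using this
    intro i
    fin_cases i
    · exact h Letter.x
    · exact h Letter.y
    · exact h (Letter.r 0)
  induction f using MvPolynomial.induction_on with
  | C a => simp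
  | add f g hf hg =>
    rw [map_add, map_add, add_sub_add_comm]
    exact add_mem hf hg
  | mul_X f i hf =>
    rw [map_mul, constantCoeff_X, mul_zero, map_zero, sub_zero]
    refine mul_mem_wordSpan ?_ (mem_wordSpan_true f) (hX i)
    intro w w' _ hw'
    rw [map_add]
    exact add_pos_of_nonneg_of_pos w.val_nonneg hw'

theorem hasLeadingWord_zero_of_constantCoeff_ne_zero {f : Poly k} (hf : constantCoeff f ≠ 0) :
    HasLeadingWord f 0 :=
  ⟨constantCoeff f, hf, 0, map_zero _, by
    rw [Word.poly_zero, smul_eq_C_mul, mul_one]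
    exact sub_C_constantCoeff_mem f⟩

theorem HasLeadingWord.pos_of_constantCoeff_eq_zero {f : Poly k} {v : ℚ} (hf : HasLeadingWord f v)
    (h0 : constantCoeff f = 0) : 0 < v := by
  by_contra! hv
  refine hf.notMem (wordSpan_mono (fun w hw => hv.trans_lt hw) ?_)
  simpa [h0] using sub_C_constantCoeff_mem f

theorem HasLeadingWord.exists_word {f : Poly k} {v : ℚ} (hf : HasLeadingWord f v) :
    ∃ w : Word, w.val = v :=
  let ⟨_, _, w, hw, _⟩ := hf
  ⟨w, hw⟩

end independence

/-! ### The valuation -/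

section valuation

variable {k : Type*} [Field k]

open Classical in
/-- The value of a polynomial: the value of its leading word. -/
def leadingValue (f : Poly k) : WithTop ℚ :=
  if h : f = 0 then ⊤ else ((exists_hasLeadingWord h).choose : ℚ)

theorem leadingValue_zero : leadingValue (0 : Poly k) = ⊤ := dif_pos rfl

theorem HasLeadingWord.leadingValue_eq {f : Poly k} {v : ℚ} (hf : HasLeadingWord f v) :
    leadingValue f = v := by
  rw [leadingValue, dif_neg hf.ne_zero, (exists_hasLeadingWord hf.ne_zero).choose_spec.unique hf]

theorem le_leadingValue_iff {f : Poly k} {v : ℚ} :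
    (v : WithTop ℚ) ≤ leadingValue f ↔ f ∈ wordSpan k fun w => v ≤ w.val := by
  by_cases hf : f = 0
  · simp [hf, leadingValue_zero]
  · obtain ⟨u, hu⟩ := exists_hasLeadingWord hf
    rw [hu.leadingValue_eq, hu.mem_iff, WithTop.coe_le_coe]

theorem leadingValue_mul (f g : Poly k) :
    leadingValue (f * g) = leadingValue f + leadingValue g := by
  by_cases hf : f = 0
  · simp [hf, leadingValue_zero]
  by_cases hg : g = 0
  · simp [hg, leadingValue_zero]
  obtain ⟨u, hu⟩ := exists_hasLeadingWord hf
  obtain ⟨v, hv⟩ := exists_hasLeadingWord hg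
  rw [hu.leadingValue_eq, hv.leadingValue_eq, (hu.mul hv).leadingValue_eq, WithTop.coe_add]

theorem leadingValue_add (f g : Poly k) :
    min (leadingValue f) (leadingValue g) ≤ leadingValue (f + g) := by
  have key : ∀ f g : Poly k, leadingValue f ≤ leadingValue g →
      leadingValue f ≤ leadingValue (f + g) := by
    intro f g h
    by_cases hf : f = 0
    · subst hf
      rwa [zero_add]
    obtain ⟨u, hu⟩ := exists_hasLeadingWord hf
    rw [hu.leadingValue_eq] at *
    rw [le_leadingValue_iff] at *
    exact add_mem (hu.mem le_rfl) h
  obtain h | h := le_total (leadingValue f) (leadingValue g)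
  · rw [min_eq_left h]
    exact key f g h
  · rw [min_eq_right h, add_comm]
    exact key g f h

theorem leadingValue_one : leadingValue (1 : Poly k) = 0 :=
  (hasLeadingWord_zero_of_constantCoeff_ne_zero (by simp)).leadingValue_eq

/-- The valuation of `k[x, y, z]` given by leading words. -/
def polyValuation (k : Type*) [Field k] : AddValuation (Poly k) (WithTop ℚ) :=
  AddValuation.of leadingValue leadingValue_zero leadingValue_one leadingValue_add
    leadingValue_mul

/-! ### Passage to the fraction field and the local ring -/

theorem exists_extension (μ : AddValuation (Poly k) (WithTop ℚ)) (hμ : ∀ f, f ≠ 0 → μ f ≠ ⊤) :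
    ∃ ν : AddValuation (RatFun k) (WithTop ℚ), ∀ f, polyVal ν f = μ f := by
  -- An additive valuation is by definition a valuation into the order dual; its support is zero
  -- here, so it extends to the localization.
  let μ' : Valuation (Poly k) (Multiplicative (WithTop ℚ)ᵒᵈ) := μ
  have hS : nonZeroDivisors (Poly k) ≤ μ'.supp.primeCompl := by
    intro f hf h
    exact hμ f (nonZeroDivisors.ne_zero hf) ((Valuation.mem_supp_iff μ' f).1 h)
  exact ⟨μ'.extendToLocalization hS (RatFun k),
    fun f => μ'.extendToLocalization_apply_map_apply hS (RatFun k) f⟩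

theorem algebraMap_ne_zero {f : Poly k} (hf : f ≠ 0) : algebraMap (Poly k) (RatFun k) f ≠ 0 :=
  fun h => hf ((IsFractionRing.to_map_eq_zero_iff).1 h)

theorem ext_of_polyVal {ν ν' : AddValuation (RatFun k) (WithTop ℚ)}
    (h : ∀ f, polyVal ν f = polyVal ν' f) : ν = ν' := by
  ext x
  obtain ⟨a, b, hb, rfl⟩ := IsFractionRing.div_surjective (A := Poly k) x
  have hb' := algebraMap_ne_zero (nonZeroDivisors.ne_zero hb)
  have hν : ∀ μ : AddValuation (RatFun k) (WithTop ℚ), polyVal μ a =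
      μ (algebraMap _ _ a / algebraMap _ _ b) + polyVal μ b := by
    intro μ
    rw [polyVal, polyVal, ← AddValuation.map_mul, div_mul_cancel₀ _ hb']
  have htop : polyVal ν b ≠ ⊤ := by
    rw [polyVal, Ne, AddValuation.top_iff]
    exact hb'
  have h1 := hν ν
  rw [h a, hν ν', ← h b] at h1
  exact (WithTop.add_right_cancel htop h1).symm

theorem mem_nonunits_localRing_iff {a b : Poly k} (hb : constantCoeff b ≠ 0)
    {f : localRing k} (hf : (f : RatFun k) = algebraMap _ _ a / algebraMap _ _ b) :
    f ∈ nonunits (localRing k) ↔ constantCoeff a = 0 := by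
  have ne_zero : ∀ {f : Poly k}, constantCoeff f ≠ 0 → algebraMap (Poly k) (RatFun k) f ≠ 0 := by
    intro f hf
    refine algebraMap_ne_zero ?_
    rintro rfl
    exact hf (map_zero _)
  rw [mem_nonunits_iff, not_iff_comm]
  constructor
  · intro ha
    have hmem : algebraMap (Poly k) (RatFun k) b / algebraMap _ _ a ∈ localRing k :=
      ⟨b, a, by rwa [mem_originIdeal_iff], rfl⟩
    refine IsUnit.of_mul_eq_one ⟨_, hmem⟩ (Subtype.ext ?_)
    change (f : RatFun k) * (_ / _) = 1
    rw [hf, div_mul_div_comm, mul_comm, div_self (mul_ne_zero (ne_zero hb) (ne_zero ha))]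
  · intro hu ha
    obtain ⟨g, hg⟩ := hu.exists_right_inv
    obtain ⟨c, d, hd, hgcd⟩ := g.2
    rw [mem_originIdeal_iff] at hd
    have h1 : (f : RatFun k) * (g : RatFun k) = 1 := by exact_mod_cast congrArg Subtype.val hg
    rw [hf, hgcd, div_mul_div_comm, div_eq_one_iff_eq (mul_ne_zero (ne_zero hb) (ne_zero hd)),
      ← map_mul, ← map_mul] at h1
    have h2 := congrArg constantCoeff (IsFractionRing.injective (Poly k) (RatFun k) h1)
    rw [map_mul, map_mul, ha, zero_mul] at h2
    exact mul_ne_zero hb hd h2.symm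

theorem polyVal_eq_zero_of_dominates {ν : AddValuation (RatFun k) (WithTop ℚ)}
    (h : Dominates ν (localRing k)) {f : Poly k} (hf : constantCoeff f ≠ 0) :
    polyVal ν f = 0 := by
  have hmem : algebraMap (Poly k) (RatFun k) f ∈ localRing k :=
    ⟨f, 1, by simp [mem_originIdeal_iff], by simp⟩
  obtain ⟨h1, h2⟩ := h ⟨_, hmem⟩
  rw [mem_nonunits_localRing_iff (a := f) (b := 1) (by simp) (by simp)] at h2
  exact le_antisymm (not_lt.1 (mt h2.1 hf)) h1

theorem polyVal_eq_of_localRing {ν : AddValuation (RatFun k) (WithTop ℚ)} {a b : Poly k}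
    (hb : polyVal ν b = 0) :
    ν (algebraMap (Poly k) (RatFun k) a / algebraMap _ _ b) = polyVal ν a := by
  have hb' : algebraMap (Poly k) (RatFun k) b ≠ 0 := by
    intro h
    rw [polyVal, h, AddValuation.map_zero] at hb
    exact WithTop.top_ne_zero hb
  have h1 : ν (algebraMap _ _ a / algebraMap _ _ b * algebraMap (Poly k) _ b) = polyVal ν a := by
    rw [div_mul_cancel₀ _ hb']
    rfl
  rw [AddValuation.map_mul] at h1
  rw [← h1]
  change _ = _ + polyVal ν b
  rw [hb, add_zero]

/-! ### Existence of the valuation -/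

theorem exP_eq (i : ℕ) : exP k (i + 2) =
    Word.poly k (Finsupp.single Letter.x (2 ^ i) + Finsupp.single (Letter.r i) 1) -
      correction k i := by
  simp [Word.poly_add, Letter.poly, correction]

theorem hasLeadingWord_exP (i : ℕ) : HasLeadingWord (exP k i) (exβ i) := by
  match i with
  | 0 =>
    simpa [Letter.poly, Letter.val, exP, exβ] using
      Word.hasLeadingWord (k := k) (Finsupp.single Letter.x 1)
  | 1 =>
    have := Word.hasLeadingWord (k := k) (Finsupp.single Letter.y 1)
    rw [Word.poly_single, pow_one, Word.val_single, Nat.cast_one, one_mul] at this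
    exact this
  | i + 2 =>
    refine ⟨1, one_ne_zero, Finsupp.single Letter.x (2 ^ i) + Finsupp.single (Letter.r i) 1,
      ?_, ?_⟩
    · simp [Letter.val]
    · rw [exP_eq, one_smul, sub_sub_cancel_left]
      refine neg_mem (wordSpan_mono (fun w hw => ?_) (correction_mem i))
      exact (lt_add_of_pos_right _ (by positivity)).trans_le hw.1

theorem hasLeadingWord_exQ (i : ℕ) : HasLeadingWord (exQ k (i + 1)) (exγ (i + 1)) := by
  cases i with
  | zero =>
    -- `Q_1` is the letter `R_1 = z`, and `9/4 = 13/4 - 1`.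
    have := Word.hasLeadingWord (k := k) (Finsupp.single (Letter.r 0) 1)
    simp only [Word.poly_single, pow_one, Word.val_single, Nat.cast_one, one_mul, Letter.poly,
      exR, Letter.val] at this
    convert this using 1
    norm_num [exγ, exβ]
  | succ i =>
    have := Word.hasLeadingWord (k := k) (Finsupp.single (Letter.q i) 1)
    simpa [Letter.poly, Letter.val] using this

theorem exists_hasDefiningData (k : Type*) [Field k] :
    ∃ ν : AddValuation (RatFun k) (WithTop ℚ), HasDefiningData exβ exγ (exP k) (exQ k) ν := by
  obtain ⟨ν, hν⟩ := exists_extension (polyValuation k) (fun f hf => by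
    obtain ⟨v, hv⟩ := exists_hasLeadingWord hf
    change leadingValue f ≠ ⊤
    rw [hv.leadingValue_eq]
    exact WithTop.coe_ne_top)
  have hlead : ∀ {f : Poly k} {v : ℚ}, HasLeadingWord f v → polyVal ν f = v :=
    fun hf => (hν _).trans hf.leadingValue_eq
  refine ⟨ν, ?_, fun i => hlead (hasLeadingWord_exP i), fun i hi => ?_⟩
  · rintro ⟨f, a, b, hb, rfl⟩
    rw [mem_originIdeal_iff] at hb
    have hb0 := hlead (hasLeadingWord_zero_of_constantCoeff_ne_zero hb)
    rw [mem_nonunits_localRing_iff hb rfl]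
    simp only [polyVal_eq_of_localRing hb0]
    by_cases ha : constantCoeff a = 0
    · have hpos : 0 < polyVal ν a := by
        by_cases ha0 : a = 0
        · rw [ha0, polyVal, map_zero, AddValuation.map_zero]
          exact WithTop.coe_lt_top 0
        · obtain ⟨v, hv⟩ := exists_hasLeadingWord ha0
          rw [hlead hv]
          exact WithTop.coe_pos.2 (hv.pos_of_constantCoeff_eq_zero ha)
      exact ⟨hpos.le, iff_of_true hpos ha⟩
    · rw [hlead (hasLeadingWord_zero_of_constantCoeff_ne_zero ha)]
      exact ⟨le_rfl, iff_of_false (lt_irrefl _) ha⟩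
  · obtain ⟨m, rfl⟩ : ∃ m, i = m + 1 := ⟨i - 1, by omega⟩
    exact hlead (hasLeadingWord_exQ m)

/-! ### Values under an arbitrary valuation with the given data -/

section data

variable {ν : AddValuation (RatFun k) (WithTop ℚ)}

theorem polyVal_mul (f g : Poly k) : polyVal ν (f * g) = polyVal ν f + polyVal ν g := by
  rw [polyVal, map_mul, AddValuation.map_mul, polyVal, polyVal]

theorem polyVal_pow {f : Poly k} {v : ℚ} (hf : polyVal ν f = v) (n : ℕ) :
    polyVal ν (f ^ n) = ((n * v : ℚ) : WithTop ℚ) := by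
  induction n with
  | zero => simp [polyVal]
  | succ n ih =>
    rw [pow_succ, polyVal_mul, ih, hf, ← WithTop.coe_add]
    rw [Nat.cast_add_one, add_mul, one_mul]

theorem le_polyVal_add {v : WithTop ℚ} {f g : Poly k} (hf : v ≤ polyVal ν f)
    (hg : v ≤ polyVal ν g) : v ≤ polyVal ν (f + g) := by
  rw [polyVal, map_add]
  exact AddValuation.map_le_add ν hf hg

theorem lt_polyVal_add {v : WithTop ℚ} {f g : Poly k} (hf : v < polyVal ν f)
    (hg : v < polyVal ν g) : v < polyVal ν (f + g) := by
  rw [polyVal, map_add]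
  exact AddValuation.map_lt_add ν hf hg

theorem polyVal_add_eq_of_lt {f g : Poly k} (h : polyVal ν f < polyVal ν g) :
    polyVal ν (f + g) = polyVal ν f := by
  rw [polyVal, map_add]
  exact AddValuation.map_add_eq_of_lt_left ν h

theorem HasDefiningData.le_polyVal_correction
    (h : HasDefiningData exβ exγ (exP k) (exQ k) ν) (i : ℕ) :
    ((exβ (i + 2) + 1 / 2 ^ (i + 2) : ℚ) : WithTop ℚ) ≤ polyVal ν (correction k i) := by
  induction i with
  | zero =>
    rw [correction_zero, h.2.2 2 (by norm_num), WithTop.coe_le_coe]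
    norm_num [exβ, exγ]
  | succ i ih =>
    have hβ : exβ (i + 1 + 2) + 1 / 2 ^ (i + 1 + 2) =
        exβ (i + 2) + 1 / 2 ^ (i + 2) + exβ (i + 2) := by
      rw [exβ]; ring
    rw [correction_succ, polyVal_mul, hβ, WithTop.coe_add]
    refine add_le_add ih (le_polyVal_add ?_ (le_trans ?_ ih))
    · rw [two_mul]
      exact le_polyVal_add (h.2.1 _).ge (h.2.1 _).ge
    · exact WithTop.coe_le_coe.2 (le_add_of_nonneg_right (by positivity))

/-- The correction has larger value than `P_{i+2}`, so `x^(2^i) R_{i+1}` has the value of `P_{i+2}`;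
then cancel the value of the power of `x`. -/
theorem HasDefiningData.polyVal_exR (h : HasDefiningData exβ exγ (exP k) (exQ k) ν) (i : ℕ) :
    polyVal ν (exR k (i + 1)) = ((exβ (i + 2) - 2 ^ i : ℚ) : WithTop ℚ) := by
  have h1 : polyVal ν (X 0 ^ 2 ^ i * exR k (i + 1)) = exβ (i + 2) := by
    rw [← h.2.1 (i + 2), ← polyVal_add_eq_of_lt (f := exP k (i + 2)) (g := correction k i),
      correction, add_sub_cancel]
    rw [h.2.1]
    refine lt_of_lt_of_le ?_ (h.le_polyVal_correction i)
    exact WithTop.coe_lt_coe.2 (lt_add_of_pos_right _ (by positivity))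
  have h2 : polyVal ν (X 0 ^ 2 ^ i) = ((2 ^ i : ℚ) : WithTop ℚ) := by
    rw [polyVal_pow (f := X 0) (v := 1) (h.2.1 0), Nat.cast_pow, Nat.cast_ofNat, mul_one]
  rw [polyVal_mul, h2] at h1
  have h3 : ((2 ^ i : ℚ) : WithTop ℚ) + ((exβ (i + 2) - 2 ^ i : ℚ) : WithTop ℚ) = exβ (i + 2) := by
    rw [← WithTop.coe_add, add_sub_cancel]
  exact WithTop.add_left_cancel WithTop.coe_ne_top (h1.trans h3.symm)

theorem HasDefiningData.polyVal_letter (h : HasDefiningData exβ exγ (exP k) (exQ k) ν)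
    (l : Letter) : polyVal ν (l.poly k) = l.val := by
  cases l with
  | x => exact h.2.1 0
  | y => exact h.2.1 1
  | q j => exact h.2.2 (j + 2) (by omega)
  | r i => exact h.polyVal_exR i

theorem HasDefiningData.polyVal_word (h : HasDefiningData exβ exγ (exP k) (exQ k) ν)
    (w : Word) : polyVal ν (w.poly k) = w.val := by
  induction w using Finsupp.induction_linear with
  | zero => simp [polyVal]
  | add w w' hw hw' => rw [Word.poly_add, polyVal_mul, hw, hw', map_add, WithTop.coe_add]
  | single l n => rw [Word.poly_single, polyVal_pow (h.polyVal_letter l), Word.val_single]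

theorem HasDefiningData.polyVal_C (h : HasDefiningData exβ exγ (exP k) (exQ k) ν) {c : k}
    (hc : c ≠ 0) : polyVal ν (C c) = 0 :=
  polyVal_eq_zero_of_dominates h.1 (by simpa using hc)

theorem HasDefiningData.lt_polyVal (h : HasDefiningData exβ exγ (exP k) (exQ k) ν) {f : Poly k}
    {v : ℚ} (hf : f ∈ wordSpan k fun w => v < w.val) : (v : WithTop ℚ) < polyVal ν f := by
  induction hf using Submodule.span_induction with
  | mem _ hw =>
    obtain ⟨w, hw, rfl⟩ := hw
    rw [h.polyVal_word]
    exact WithTop.coe_lt_coe.2 hw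
  | zero =>
    rw [polyVal, map_zero, AddValuation.map_zero]
    exact WithTop.coe_lt_top v
  | add f g _ _ hf hg => exact lt_polyVal_add hf hg
  | smul c f _ hf =>
    by_cases hc : c = 0
    · rw [hc, zero_smul, polyVal, map_zero, AddValuation.map_zero]
      exact WithTop.coe_lt_top v
    · rwa [smul_eq_C_mul, polyVal_mul, h.polyVal_C hc, zero_add]

/-- Domination makes nonzero constants have value 0, so the leading word alone determines the value,
whatever the valuation. -/
theorem HasDefiningData.polyVal_eq (h : HasDefiningData exβ exγ (exP k) (exQ k) ν) {f : Poly k}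
    {v : ℚ} (hf : HasLeadingWord f v) : polyVal ν f = v := by
  obtain ⟨c, hc, w, rfl, hw⟩ := hf
  have h1 : polyVal ν (c • w.poly k) = w.val := by
    rw [smul_eq_C_mul, polyVal_mul, h.polyVal_C hc, zero_add, h.polyVal_word]
  have h2 := polyVal_add_eq_of_lt (h1.trans_lt (h.lt_polyVal hw))
  rw [add_sub_cancel] at h2
  exact h2.trans h1

theorem HasDefiningData.unique {ν' : AddValuation (RatFun k) (WithTop ℚ)}
    (h : HasDefiningData exβ exγ (exP k) (exQ k) ν)
    (h' : HasDefiningData exβ exγ (exP k) (exQ k) ν') : ν = ν' := by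
  refine ext_of_polyVal fun f => ?_
  by_cases hf : f = 0
  · rw [hf, polyVal, polyVal, map_zero, AddValuation.map_zero, AddValuation.map_zero]
  · obtain ⟨v, hv⟩ := exists_hasLeadingWord hf
    rw [h.polyVal_eq hv, h'.polyVal_eq hv]

/-! ### The value semigroup -/

theorem Word.val_mem_closure (w : Word) : w.val ∈ AddSubmonoid.closure (Set.range Letter.val) := by
  rw [Word.val, Finsupp.weight_apply]
  exact sum_mem fun l _ => nsmul_mem (AddSubmonoid.subset_closure (Set.mem_range_self l)) _

theorem range_letter_val : Set.range Letter.val =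
    {(1 : ℚ), 3 / 2} ∪ {v : ℚ | ∃ i : ℕ, 2 ≤ i ∧ v = exγ i} ∪
      {v : ℚ | ∃ i : ℕ, 1 ≤ i ∧ v = exβ (i + 1) - 2 ^ (i - 1)} := by
  ext v
  constructor
  · rintro ⟨l, rfl⟩
    cases l with
    | x => exact Or.inl (Or.inl (Or.inl rfl))
    | y => exact Or.inl (Or.inl (Or.inr rfl))
    | q j => exact Or.inl (Or.inr ⟨j + 2, by omega, rfl⟩)
    | r i => exact Or.inr ⟨i + 1, by omega, rfl⟩
  · rintro (((rfl | rfl) | ⟨i, hi, rfl⟩) | ⟨i, hi, rfl⟩)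
    · exact ⟨Letter.x, rfl⟩
    · exact ⟨Letter.y, rfl⟩
    · obtain ⟨j, rfl⟩ : ∃ j, i = j + 2 := ⟨i - 2, by omega⟩
      exact ⟨Letter.q j, rfl⟩
    · obtain ⟨j, rfl⟩ : ∃ j, i = j + 1 := ⟨i - 1, by omega⟩
      exact ⟨Letter.r j, rfl⟩

theorem HasDefiningData.valueSemigroup_eq (h : HasDefiningData exβ exγ (exP k) (exQ k) ν) :
    valueSemigroup ν (localRing k) = (AddSubmonoid.closure (Set.range Letter.val) : Set ℚ) := by
  have hword : ∀ w : Word, w.val ∈ valueSemigroup ν (localRing k) := by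
    intro w
    refine ⟨algebraMap _ _ (w.poly k), ⟨w.poly k, 1, by simp [mem_originIdeal_iff], by simp⟩,
      algebraMap_ne_zero w.hasLeadingWord.ne_zero, h.polyVal_word w⟩
  refine Set.Subset.antisymm ?_ ?_
  · rintro v ⟨_, ⟨a, b, hb, rfl⟩, hne, hv⟩
    rw [mem_originIdeal_iff] at hb
    -- Denominators have nonzero constant term, hence value 0, so only polynomials matter.
    rw [polyVal_eq_of_localRing (polyVal_eq_zero_of_dominates h.1 hb)] at hv
    have ha : a ≠ 0 := by
      rintro rfl
      simp at hne
    obtain ⟨u, hu⟩ := exists_hasLeadingWord ha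
    rw [h.polyVal_eq hu, WithTop.coe_inj] at hv
    obtain ⟨w, rfl⟩ := hu.exists_word
    exact hv ▸ w.val_mem_closure
  · intro v hv
    have hex : ∃ w : Word, w.val = v := by
      induction hv using AddSubmonoid.closure_induction with
      | mem _ hl =>
        obtain ⟨l, rfl⟩ := hl
        exact ⟨Finsupp.single l 1, by simp⟩
      | zero => exact ⟨0, map_zero _⟩
      | add _ _ _ _ h1 h2 =>
        obtain ⟨w, rfl⟩ := h1
        obtain ⟨w', rfl⟩ := h2
        exact ⟨w + w', map_add _ _ _⟩
    obtain ⟨w, rfl⟩ := hex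
    exact hword w

end data

end valuation

end ValSemigroup

end

theorem theorem7p10 (k : Type*) [Field k] :
    -- `P_i`, `Q_i` are the defining polynomials of the numerical data `β`, `γ` with all residues
    -- equal to `1`, the data determine a valuation, and `r_{i,0}` is `1` for `i = 1` and else `0`
    (∃ e : ValSemigroup.DefiningExponents ValSemigroup.exβ ValSemigroup.exγ,
      e.Admissible ∧
      ValSemigroup.IsDefiningSequence e (fun _ => (1 : k)) (fun _ => (1 : k))
        (ValSemigroup.exP k) (ValSemigroup.exQ k) ∧
      ∀ i, 1 ≤ i → e.r i = if i = 1 then 1 else 0) ∧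
    -- there is exactly one valuation with these data
    (∃! ν : AddValuation (ValSemigroup.RatFun k) (WithTop ℚ),
      ValSemigroup.HasDefiningData ValSemigroup.exβ ValSemigroup.exγ
        (ValSemigroup.exP k) (ValSemigroup.exQ k) ν) ∧
    -- its value semigroup
    ∀ ν : AddValuation (ValSemigroup.RatFun k) (WithTop ℚ),
      ValSemigroup.HasDefiningData ValSemigroup.exβ ValSemigroup.exγ
        (ValSemigroup.exP k) (ValSemigroup.exQ k) ν →
      (∀ i : ℕ, 1 ≤ i → ValSemigroup.polyVal ν (ValSemigroup.exR k i) =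
        ((ValSemigroup.exβ (i + 1) - 2 ^ (i - 1) : ℚ) : WithTop ℚ)) ∧
      ValSemigroup.valueSemigroup ν (ValSemigroup.localRing k) =
        (AddSubmonoid.closure
          ({(1 : ℚ), 3 / 2} ∪ {v : ℚ | ∃ i : ℕ, 2 ≤ i ∧ v = ValSemigroup.exγ i} ∪
            {v : ℚ | ∃ i : ℕ, 1 ≤ i ∧ v = ValSemigroup.exβ (i + 1) - 2 ^ (i - 1)}) : Set ℚ) := by
  refine ⟨⟨ValSemigroup.exExponents, ValSemigroup.exExponents_admissible,
    ValSemigroup.exExponents_isDefiningSequence k, fun i _ => ValSemigroup.exExponents_r i⟩,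
    ?_, fun ν h => ⟨fun i hi => ?_, ?_⟩⟩
  · obtain ⟨ν, hν⟩ := ValSemigroup.exists_hasDefiningData k
    exact ⟨ν, hν, fun ν' hν' => hν'.unique hν⟩
  · obtain ⟨m, rfl⟩ : ∃ m, i = m + 1 := ⟨i - 1, by omega⟩
    exact h.polyVal_exR m
  · rw [h.valueSemigroup_eq, ValSemigroup.range_letter_val]
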